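/- Let $\Gamma=(V,E)$ be an infinite connected simple graph with graph distance $d$ and closed balls $B(z,r)=\{x\in V: d(z,x)\le r\}$. Let $\pi:V\to(0,\infty)$ be vertex weights and let $\mu_{xy}=\mu_{yx}\ge 0$ be edge weights with $\mu_{xy}\neq 0\iff\{x,y\}\in E$ and $\sum_{y}\mu_{xy}\le\pi(x)$ for all $x$. Assume that the weights are controlled, i.e. $\mu_{xy}/\pi(x)\ge 1/C_c$ whenever $x\sim y$ for some constant $C_c>1$, and uniformly lazy, i.e. $\sum_{y}\mu_{xy}\le(1-C_e)\pi(x)$ for all $x$ and some constant $C_e\in(0,1)$. Let $\mathcal K(x,y)=\mu_{xy}/\pi(x)$ for $x\neq y$ and $\mathcal K(x,x)=1-\sum_{z}\mu_{xz}/\pi(x)$ be the associated Markov kernel and let $p(n,x,y)=\mathcal K^n(x,y)/\pi(y)$ be its heat kernel. For a finite non-empty $\Omega\subset V$ put $\pi(\Omega)=\sum_{x\in\Omega}\pi(x)$ and let $$\lambda_1(\Omega)=\inf\left\{\frac{\frac12\sum_{x,y}|f(x)-f(y)|^2\mu_{xy}}{\sum_x|f(x)|^2\pi(x)}:\ f:V\to\mathbb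 R,\ f\ne0,\ \operatorname{supp}f\subseteq\Omega\right\}$$ be the first Dirichlet eigenvalue of the Laplacian in $\Omega$. Suppose that, for some constants $C,\alpha>0$ and some function $F:V\times[1,\infty)\to(0,\infty)$ (not assumed to be doubling), the function $$\Lambda(B(z,r),\nu)=\frac{C}{r^2}\Big(\frac{F(z,r)}{\nu}\Big)^{\alpha}$$ is a relative Faber–Krahn function of $\Gamma$: it is non-increasing in $\nu>0$ and $\lambda_1(\Omega)\ge\Lambda(B(z,r),\pi(\Omega))$ for all $z\in V$, $r\ge1$ and all non-empty $\Omega\subseteq B(z,r)$. Then there are constants $c_1,c_2>0$, depending only on $C_c,C_e,C,\alpha$, such that for all $x,y\in V$ and all integers $n>0$, $$p(n,x,y)\le\frac{c_1}{\sqrt{F(x,\sqrt n)\,F(y,\sqrt n)}}\exp\Big(-\frac{d^2(x,y)}{c_2n}\Big).$$ -/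

import Mathlib

universe u

noncomputable section

/-- A random walk structure on a simple graph `G`: nonnegative symmetric edge weights `μ x y`
(conductances) adapted to the edges of `G`, and positive vertex weights `π x` (the measure), such
that the edge weights are subordinate to the vertex weights. -/
structure WeightedGraph {V : Type u} (G : SimpleGraph V) where
  /-- edge weights -/
  μ : V → V → ℝ
  /-- vertex weights -/
  π : V → ℝ
  μ_nonneg : ∀ x y, 0 ≤ μ x y
  μ_symm : ∀ x y, μ x y = μ y x
  μ_adapted : ∀ x y, μ x y ≠ 0 ↔ G.Adj x y
  π_pos : ∀ x, 0 < π x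
  μ_summable : ∀ x, Summable (μ x)
  μ_subordinate : ∀ x, ∑' y, μ x y ≤ π x

namespace WeightedGraph

variable {V : Type u} {G : SimpleGraph V} (w : WeightedGraph G)

/-- Controlled weights with constant `Cc`: `μ x y / π x ≥ 1 / Cc` for every edge. -/
def ControlledWeights (Cc : ℝ) : Prop :=
  ∀ x y, G.Adj x y → 1 / Cc ≤ w.μ x y / w.π x

/-- Uniformly lazy with constant `Ce`. -/
def UniformlyLazy (Ce : ℝ) : Prop :=
  ∀ x, ∑' y, w.μ x y ≤ (1 - Ce) * w.π x

open Classical in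
/-- The Markov kernel of the random walk. -/
def markovKernel (x y : V) : ℝ :=
  if x = y then 1 - ∑' z, w.μ x z / w.π x else w.μ x y / w.π x

open Classical in
/-- The convolution powers of the Markov kernel (the `n`-step transition probabilities). -/
def markovKernelPow : ℕ → V → V → ℝ
  | 0 => fun x y => if x = y then 1 else 0
  | n + 1 => fun x y => ∑' z, w.markovKernel x z * markovKernelPow n z y

/-- The heat kernel `p(n, x, y)`: the transition density with respect to `π`. -/
def heatKernel (n : ℕ) (x y : V) : ℝ :=
  w.markovKernelPow n x y / w.π y

/-- The Dirichlet energy `‖ |∇f| ‖₂²`. -/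
def energy (f : V → ℝ) : ℝ :=
  (1 / 2) * ∑' x, ∑' y, |f x - f y| ^ 2 * w.μ x y

/-- The squared `L²(π)` norm. -/
def normSq (f : V → ℝ) : ℝ :=
  ∑' x, |f x| ^ 2 * w.π x

/-- The first Dirichlet eigenvalue of the Laplacian in a finite set `Ω`, as the infimum of the
Rayleigh quotients of the nonzero functions supported in `Ω`. -/
def dirichletEigenvalue (Ω : Finset V) : ℝ :=
  sInf {q : ℝ | ∃ f : V → ℝ, Function.support f ⊆ (Ω : Set V) ∧ f ≠ 0 ∧
    q = w.energy f / w.normSq f}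

/-- `Λ z r ν` is a relative Faber–Krahn function, as a function of the ball `B(z,r)`, `r ≥ 1`
(given by its centre and radius) and of the volume `ν > 0`. Since `G` will be connected and locally
finite, every subset of a ball is finite and `G.dist` is the graph distance. -/
structure IsRelativeFaberKrahn (Λ : V → ℝ → ℝ → ℝ) : Prop where
  antitone : ∀ (z : V) (r : ℝ), 1 ≤ r → AntitoneOn (Λ z r) (Set.Ioi 0)
  le_eigenvalue : ∀ (z : V) (r : ℝ), 1 ≤ r → ∀ Ω : Finset V, Ω.Nonempty →
    (∀ x ∈ Ω, (G.dist z x : ℝ) ≤ r) →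
    Λ z r (∑ x ∈ Ω, w.π x) ≤ w.dirichletEigenvalue Ω

end WeightedGraph

end

/-! In `n` steps the walk cannot leave the `n`-neighbourhood of `{x, y}`, so the walk may be killed
outside a finite set, and everything reduces to reversible substochastic kernels `P` on finite sets.

Two mechanisms are combined there. Laziness gives Davies' estimate `ip_exp_op_le`: one step of `P`
multiplies the norm of `exp(sρ) f` in `L²(π)` squared by at most `exp(10 s²/δ)`. Faber–Krahn gives a
Nash inequality for functions supported in the ball of radius `r = √n`, and hence polynomial decay
of the norm of the density, as long as its mass stays mostly in that ball.

Each mechanism supplies what the other lacks, so `density_bounds` proves by one induction on `t ≤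
r²/y²` (with a large constant `y`) both the decay of the norm and a bound for the norm with weight
`exp(ρ/√(t+1))`. The weighted bound makes the tail outside the half ball negligible. Faber–Krahn is
used at the single scale `r` only, so no doubling of `F` is needed.

Starting from a time of order `n/(y² + s²n)`, Davies' estimate carries the bound for the weight
`exp(sρ)` up to times between `n/2` and `n`. Cauchy–Schwarz for `p(n,x,y)`, split at half time, and
an optimal choice of `s` give the Gaussian factor. -/

noncomputable section

/-! ### Energy identities and laziness for finite reversible kernels -/

/-- A symmetric substochastic kernel `a x y / π x` on a finite set, reversible with respect to the
measure `π` and with holding probabilities at least `δ`. -/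
structure LazyKernel (ι : Type*) [Fintype ι] (δ : ℝ) where
  /-- the symmetric weights of the kernel -/
  a : ι → ι → ℝ
  /-- the reversible measure -/
  π : ι → ℝ
  a_nonneg : ∀ x y, 0 ≤ a x y
  a_symm : ∀ x y, a x y = a y x
  π_pos : ∀ x, 0 < π x
  sum_le : ∀ x, ∑ y, a x y ≤ π x
  lazy : ∀ x, δ * π x ≤ a x x

namespace LazyKernel

variable {ι : Type*} [Fintype ι] {δ : ℝ} (k : LazyKernel ι δ)

/-- The inner product of `L²(π)`. -/
def ip (f g : ι → ℝ) : ℝ := ∑ x, f x * g x * k.π x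

/-- The operator with kernel `a x y * m x y / π x`. -/
def twist (m : ι → ι → ℝ) (f : ι → ℝ) (x : ι) : ℝ := (∑ y, k.a x y * m x y * f y) / k.π x

/-- The Markov operator. -/
def op (f : ι → ℝ) (x : ι) : ℝ := (∑ y, k.a x y * f y) / k.π x

/-- The bilinear form of the Markov operator. -/
def form (f g : ι → ℝ) : ℝ := ∑ x, ∑ y, k.a x y * f x * g y

/-- The Dirichlet form. -/
def dirichlet (f : ι → ℝ) : ℝ := k.ip f f - k.form f f

lemma ip_comm (f g : ι → ℝ) : k.ip f g = k.ip g f := by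
  simp only [ip, mul_comm (f _)]

lemma ip_self_nonneg (f : ι → ℝ) : 0 ≤ k.ip f f :=
  Finset.sum_nonneg fun x _ => mul_nonneg (mul_self_nonneg _) (k.π_pos x).le

lemma ip_twist (m : ι → ι → ℝ) (f g : ι → ℝ) :
    k.ip f (k.twist m g) = ∑ x, ∑ y, k.a x y * m x y * f x * g y := by
  refine Finset.sum_congr rfl fun x _ => ?_
  have := (k.π_pos x).ne'
  rw [twist, mul_assoc, div_mul_cancel₀ _ this, Finset.mul_sum]
  exact Finset.sum_congr rfl fun y _ => by ring

lemma op_eq_twist (f : ι → ℝ) : k.op f = k.twist (fun _ _ => 1) f := by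
  ext x; simp [op, twist]

lemma ip_op (f g : ι → ℝ) : k.ip f (k.op g) = k.form f g := by
  rw [op_eq_twist, ip_twist]; simp [form]

lemma form_comm (f g : ι → ℝ) : k.form f g = k.form g f := by
  rw [form, Finset.sum_comm]
  refine Finset.sum_congr rfl fun x _ => Finset.sum_congr rfl fun y _ => ?_
  rw [k.a_symm]; ring

lemma ip_add_left (f g h : ι → ℝ) : k.ip (f + g) h = k.ip f h + k.ip g h := by
  simp [ip, add_mul, Finset.sum_add_distrib]

lemma ip_add_right (f g h : ι → ℝ) : k.ip f (g + h) = k.ip f g + k.ip f h := by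
  simp [ip, mul_add, add_mul, Finset.sum_add_distrib]

lemma ip_sub_left (f g h : ι → ℝ) : k.ip (f - g) h = k.ip f h - k.ip g h := by
  simp [ip, sub_mul, Finset.sum_sub_distrib]

lemma ip_sub_right (f g h : ι → ℝ) : k.ip f (g - h) = k.ip f g - k.ip f h := by
  simp [ip, mul_sub, sub_mul, Finset.sum_sub_distrib]

lemma ip_smul_left (c : ℝ) (f g : ι → ℝ) : k.ip (c • f) g = c * k.ip f g := by
  simp [ip, Finset.mul_sum, mul_assoc]

lemma form_sub_left (f g h : ι → ℝ) : k.form (f - g) h = k.form f h - k.form g h := by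
  simp [form, mul_sub, sub_mul, Finset.sum_sub_distrib]

lemma form_smul_left (c : ℝ) (f g : ι → ℝ) : k.form (c • f) g = c * k.form f g := by
  simp only [form, Finset.mul_sum, Pi.smul_apply, smul_eq_mul]
  exact Finset.sum_congr rfl fun x _ => Finset.sum_congr rfl fun y _ => by ring

lemma sum_sum_mul_left (f : ι → ℝ) :
    ∑ x, ∑ y, k.a x y * f x = ∑ x, f x * ∑ y, k.a x y := by
  simp [Finset.mul_sum, mul_comm]

lemma sum_sum_mul_right (f : ι → ℝ) :
    ∑ x, ∑ y, k.a x y * f y = ∑ x, f x * ∑ y, k.a x y := by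
  rw [Finset.sum_comm, ← sum_sum_mul_left]
  exact Finset.sum_congr rfl fun x _ => Finset.sum_congr rfl fun y _ => by rw [k.a_symm]

/-- Besides the differences, the form carries a killing term, nonnegative because the kernel is
substochastic. Nonnegativity and the contraction property can be read off. -/
lemma dirichlet_eq (f : ι → ℝ) :
    k.dirichlet f = (1 / 2) * (∑ x, ∑ y, k.a x y * (f x - f y) ^ 2) +
      ∑ x, (k.π x - ∑ y, k.a x y) * f x ^ 2 := by
  have h1 : ∑ x, ∑ y, k.a x y * (f x - f y) ^ 2 =
      ∑ x, ∑ y, k.a x y * (f x ^ 2) + ∑ x, ∑ y, k.a x y * (f y ^ 2) - 2 * k.form f f := by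
    simp only [form, Finset.mul_sum, ← Finset.sum_add_distrib, ← Finset.sum_sub_distrib]
    exact Finset.sum_congr rfl fun x _ => Finset.sum_congr rfl fun y _ => by ring
  rw [h1, k.sum_sum_mul_left (fun x => f x ^ 2), k.sum_sum_mul_right (fun x => f x ^ 2)]
  have h2 : ∑ x, (k.π x - ∑ y, k.a x y) * f x ^ 2 =
      k.ip f f - ∑ x, f x ^ 2 * ∑ y, k.a x y := by
    rw [ip, ← Finset.sum_sub_distrib]
    exact Finset.sum_congr rfl fun x _ => by ring
  rw [h2, dirichlet]; ring

lemma dirichlet_nonneg (f : ι → ℝ) : 0 ≤ k.dirichlet f := by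
  rw [dirichlet_eq]
  refine add_nonneg (mul_nonneg (by norm_num) ?_) ?_
  · exact Finset.sum_nonneg fun x _ => Finset.sum_nonneg fun y _ =>
      mul_nonneg (k.a_nonneg x y) (sq_nonneg _)
  · exact Finset.sum_nonneg fun x _ => mul_nonneg (sub_nonneg.2 (k.sum_le x)) (sq_nonneg _)

lemma form_le_ip (f : ι → ℝ) : k.form f f ≤ k.ip f f := sub_nonneg.1 (k.dirichlet_nonneg f)

/-- Sums `f x + f y` in place of differences: the diagonal terms alone contribute `4δ` times the
squared norm, which keeps the spectrum of `P` above `-1 + 2δ`. -/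
lemma dirichlet_le (f : ι → ℝ) : k.dirichlet f ≤ (2 - 2 * δ) * k.ip f f := by
  have h1 : ∑ x, ∑ y, k.a x y * (f x + f y) ^ 2 =
      ∑ x, ∑ y, k.a x y * (f x ^ 2) + ∑ x, ∑ y, k.a x y * (f y ^ 2) + 2 * k.form f f := by
    simp only [form, Finset.mul_sum, ← Finset.sum_add_distrib]
    exact Finset.sum_congr rfl fun x _ => Finset.sum_congr rfl fun y _ => by ring
  rw [k.sum_sum_mul_left (fun x => f x ^ 2), k.sum_sum_mul_right (fun x => f x ^ 2)] at h1
  have h2 : ∑ x, f x ^ 2 * ∑ y, k.a x y ≤ k.ip f f :=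
    Finset.sum_le_sum fun x _ => by
      nlinarith [mul_le_mul_of_nonneg_left (k.sum_le x) (sq_nonneg (f x))]
  have h3 : 4 * δ * k.ip f f ≤ ∑ x, ∑ y, k.a x y * (f x + f y) ^ 2 := by
    rw [ip, Finset.mul_sum]
    refine Finset.sum_le_sum fun x _ => le_trans ?_
      (Finset.single_le_sum (f := fun y => k.a x y * (f x + f y) ^ 2)
        (fun y _ => mul_nonneg (k.a_nonneg x y) (sq_nonneg _)) (Finset.mem_univ x))
    nlinarith [mul_le_mul_of_nonneg_left (k.lazy x) (sq_nonneg (f x))]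
  rw [dirichlet]; linarith

lemma dirichlet_smul_sub (c : ℝ) (f g : ι → ℝ) :
    k.dirichlet (c • f - g) =
      c ^ 2 * k.dirichlet f - 2 * c * (k.ip g f - k.form g f) + k.dirichlet g := by
  simp only [dirichlet, ip_sub_left, ip_smul_left, form_sub_left, form_smul_left,
    k.ip_comm _ (c • f - g), k.form_comm _ (c • f - g)]
  rw [k.ip_comm f (c • f), k.form_comm f (c • f), k.ip_comm g (c • f), k.form_comm g (c • f)]
  simp only [ip_smul_left, form_smul_left, k.ip_comm f g, k.form_comm f g]
  ring

/-- With `Δ = I - P` this is `Δ² ≤ (2 - 2δ) Δ`. It follows without the spectral theorem from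
nonnegativity of the Dirichlet form at `(2 - 2δ) f - Δf`. -/
lemma ip_laplacian_le (hδ : δ < 1) (f : ι → ℝ) :
    k.ip (f - k.op f) (f - k.op f) ≤ (2 - 2 * δ) * k.dirichlet f := by
  set g := f - k.op f with hg
  have h1 : k.ip g f - k.form g f = k.ip g g := by
    rw [← ip_op, ← ip_sub_right]
  have h2 := k.dirichlet_nonneg ((2 - 2 * δ) • f - g)
  rw [dirichlet_smul_sub, h1] at h2
  have h3 := k.dirichlet_le g
  have hc : 0 < 2 - 2 * δ := by linarith
  nlinarith

lemma ip_op_op (f : ι → ℝ) : k.ip (k.op f) (k.op f) =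
    k.ip f f - 2 * k.dirichlet f + k.ip (f - k.op f) (f - k.op f) := by
  simp only [ip_sub_left, ip_sub_right, k.ip_comm (k.op f) f, dirichlet, ← ip_op]
  ring

lemma ip_op_op_le_dirichlet (hδ : δ < 1) (f : ι → ℝ) :
    k.ip (k.op f) (k.op f) ≤ k.ip f f - 2 * δ * k.dirichlet f := by
  have := k.ip_laplacian_le hδ f
  rw [ip_op_op]; linarith

/-- The loss of norm in one step, measured by `f - Pf`. It absorbs the first-order error in Davies'
estimate. -/
lemma ip_op_op_le_laplacian (hδ0 : 0 < δ) (hδ : δ < 1) (f : ι → ℝ) :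
    k.ip (k.op f) (k.op f) ≤ k.ip f f - δ * k.ip (f - k.op f) (f - k.op f) := by
  have h := k.ip_laplacian_le hδ f
  have h0 := k.ip_self_nonneg (f - k.op f)
  rw [ip_op_op]
  nlinarith [mul_le_mul_of_nonneg_left h (by linarith : 0 ≤ 1 + δ),
    mul_nonneg (sq_nonneg δ) (k.dirichlet_nonneg f)]

lemma ip_op_op_le (hδ0 : 0 < δ) (hδ : δ < 1) (f : ι → ℝ) :
    k.ip (k.op f) (k.op f) ≤ k.ip f f := by
  have := k.ip_op_op_le_laplacian hδ0 hδ f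
  nlinarith [k.ip_self_nonneg (f - k.op f)]

/-! ### Davies' estimate for the conjugated operator -/

lemma ip_abs (f : ι → ℝ) : k.ip |f| |f| = k.ip f f := by
  simp [ip]

lemma ip_self_mono {f g : ι → ℝ} (h : ∀ x, |f x| ≤ |g x|) : k.ip f f ≤ k.ip g g :=
  Finset.sum_le_sum fun x _ => mul_le_mul_of_nonneg_right
    (abs_le_iff_mul_self_le.1 (h x)) (k.π_pos x).le

lemma op_nonneg {f : ι → ℝ} (hf : ∀ x, 0 ≤ f x) (x : ι) : 0 ≤ k.op f x :=
  div_nonneg (Finset.sum_nonneg fun y _ => mul_nonneg (k.a_nonneg x y) (hf y)) (k.π_pos x).le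

lemma ip_twist_twist_le (hδ0 : 0 < δ) (hδ : δ < 1) {m : ι → ι → ℝ} {M : ℝ} (hM : 0 ≤ M)
    (hm : ∀ x y, k.a x y ≠ 0 → |m x y| ≤ M) (f : ι → ℝ) :
    k.ip (k.twist m f) (k.twist m f) ≤ M ^ 2 * k.ip f f := by
  have h1 : k.ip (k.twist m f) (k.twist m f) ≤ k.ip (M • k.op |f|) (M • k.op |f|) := by
    refine k.ip_self_mono fun x => ?_
    have h0 : 0 ≤ k.op |f| x := k.op_nonneg (fun y => abs_nonneg _) x
    rw [Pi.smul_apply, smul_eq_mul, abs_of_nonneg (mul_nonneg hM h0), twist, op, abs_div,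
      abs_of_pos (k.π_pos x), ← mul_div_assoc]
    refine div_le_div_of_nonneg_right ?_ (k.π_pos x).le
    refine (Finset.abs_sum_le_sum_abs _ _).trans ?_
    rw [Finset.mul_sum]
    refine Finset.sum_le_sum fun y _ => ?_
    rw [abs_mul, abs_mul, abs_of_nonneg (k.a_nonneg x y), Pi.abs_apply]
    rcases eq_or_ne (k.a x y) 0 with h | h
    · simp [h]
    · have := mul_le_mul_of_nonneg_left (hm x y h)
        (mul_nonneg (k.a_nonneg x y) (abs_nonneg (f y)))
      linarith
  refine h1.trans ?_
  rw [ip_smul_left, k.ip_comm, ip_smul_left]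
  have := k.ip_op_op_le hδ0 hδ |f|
  rw [ip_abs] at this
  nlinarith [mul_le_mul_of_nonneg_left this (sq_nonneg M)]

/-- Only the symmetric part of `m` enters the quadratic form. For `m = exp(ψ x - ψ y) - 1` that part
is of second order in the Lipschitz constant, although `m` itself is of first order. -/
lemma ip_twist_self_le {m : ι → ι → ℝ} {M : ℝ}
    (hm : ∀ x y, k.a x y ≠ 0 → |m x y + m y x| ≤ 2 * M) (f : ι → ℝ) (hM : 0 ≤ M) :
    k.ip f (k.twist m f) ≤ M * k.ip f f := by
  have h1 : 2 * k.ip f (k.twist m f) =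
      ∑ x, ∑ y, k.a x y * (m x y + m y x) * f x * f y := by
    rw [two_mul]
    nth_rw 2 [ip_twist]
    rw [Finset.sum_comm, ip_twist, ← Finset.sum_add_distrib]
    refine Finset.sum_congr rfl fun x _ => ?_
    rw [← Finset.sum_add_distrib]
    refine Finset.sum_congr rfl fun y _ => ?_
    rw [k.a_symm y x]; ring
  have h2 : 2 * k.ip f (k.twist m f) ≤ 2 * M * k.form |f| |f| := by
    rw [h1, form, Finset.mul_sum]
    refine Finset.sum_le_sum fun x _ => ?_
    rw [Finset.mul_sum]
    refine Finset.sum_le_sum fun y _ => ?_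
    rcases eq_or_ne (k.a x y) 0 with h | h
    · simp [h]
    · refine (le_abs_self _).trans ?_
      rw [abs_mul, abs_mul, abs_mul, abs_of_nonneg (k.a_nonneg x y)]
      have := mul_le_mul_of_nonneg_left (hm x y h) (mul_nonneg (mul_nonneg (k.a_nonneg x y)
        (abs_nonneg (f x))) (abs_nonneg (f y)))
      simp only [Pi.abs_apply]
      linarith
  have h3 := k.form_le_ip |f|
  rw [ip_abs] at h3
  nlinarith [mul_le_mul_of_nonneg_left h3 hM]

lemma two_mul_ip_le {ε : ℝ} (hε : 0 < ε) (f g : ι → ℝ) :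
    2 * k.ip f g ≤ ε * k.ip f f + (1 / ε) * k.ip g g := by
  simp only [ip, Finset.mul_sum, ← Finset.sum_add_distrib]
  refine Finset.sum_le_sum fun x _ => ?_
  have h : 2 * (f x * g x) ≤ ε * (f x * f x) + 1 / ε * (g x * g x) := by
    have : 0 ≤ (1 / ε) * (ε * f x - g x) ^ 2 := by positivity
    have e : (1 / ε) * (ε * f x - g x) ^ 2 =
      ε * (f x * f x) + 1 / ε * (g x * g x) - 2 * (f x * g x) := by field_simp; ring
    linarith
  nlinarith [mul_le_mul_of_nonneg_right h (k.π_pos x).le]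

lemma twist_sub (m : ι → ι → ℝ) (f g : ι → ℝ) :
    k.twist m (f - g) = k.twist m f - k.twist m g := by
  ext x
  simp [twist, mul_sub, Finset.sum_sub_distrib, sub_div]

lemma exp_mul_op_eq (ψ f : ι → ℝ) :
    (fun x => Real.exp (ψ x) * k.op f x) =
      k.twist (fun x y => Real.exp (ψ x - ψ y)) (fun x => Real.exp (ψ x) * f x) := by
  ext x
  rw [op, twist, ← mul_div_assoc, Finset.mul_sum]
  congr 1
  refine Finset.sum_congr rfl fun y _ => ?_
  rw [Real.exp_sub]
  have := (Real.exp_pos (ψ y)).ne'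
  field_simp

/-- Davies' estimate for the Markov operator conjugated by a Lipschitz weight. -/
lemma ip_exp_op_le (hδ0 : 0 < δ) (hδ : δ < 1) {ψ : ι → ℝ} {s : ℝ} (hs : 0 ≤ s)
    (hψ : ∀ x y, k.a x y ≠ 0 → |ψ x - ψ y| ≤ s) (f : ι → ℝ) :
    k.ip (fun x => Real.exp (ψ x) * k.op f x) (fun x => Real.exp (ψ x) * k.op f x) ≤
      Real.exp (10 / δ * s ^ 2) *
        k.ip (fun x => Real.exp (ψ x) * f x) (fun x => Real.exp (ψ x) * f x) := by
  rw [exp_mul_op_eq]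
  set g : ι → ℝ := fun x => Real.exp (ψ x) * f x
  have hg0 := k.ip_self_nonneg g
  have hδi : 1 < 1 / δ := by rw [lt_div_iff₀ hδ0]; linarith
  have h10 : 10 / δ = 10 * (1 / δ) := by ring
  rcases le_or_gt s 1 with hs1 | hs1
  · set D : ι → ι → ℝ := fun x y => Real.exp (ψ x - ψ y) - 1 with hD
    have hT : k.twist (fun x y => Real.exp (ψ x - ψ y)) g = k.op g + k.twist D g := by
      ext x
      simp [op, twist, D, mul_sub, sub_mul, ← add_div]
    have he : ∀ t : ℝ, |t| ≤ 1 → Real.exp t ≤ 1 + t + t ^ 2 := fun t ht => by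
      have := (abs_le.1 (Real.abs_exp_sub_one_sub_id_le ht)).2
      linarith
    have he' : ∀ t : ℝ, 1 + t ≤ Real.exp t := fun t => by
      have := Real.add_one_le_exp t; linarith
    have hD1 : ∀ x y, k.a x y ≠ 0 → |D x y| ≤ 2 * s := fun x y h => by
      have h1 := hψ x y h
      have h2 := he _ (h1.trans hs1)
      have h3 := he' (ψ x - ψ y)
      have h4 := abs_le.1 h1
      have h5 : (ψ x - ψ y) ^ 2 ≤ s ^ 2 := sq_le_sq' h4.1 h4.2
      rw [abs_le]
      constructor <;> simp only [D] <;> nlinarith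
    have hD2 : ∀ x y, k.a x y ≠ 0 → |D x y + D y x| ≤ 2 * s ^ 2 := fun x y h => by
      have h1 := hψ x y h
      have h2 := he _ (h1.trans hs1)
      have h2' := he (ψ y - ψ x) (by rw [abs_sub_comm]; exact h1.trans hs1)
      have h3 := he' (ψ x - ψ y)
      have h3' := he' (ψ y - ψ x)
      have h4 := abs_le.1 h1
      have h5 : (ψ x - ψ y) ^ 2 ≤ s ^ 2 := sq_le_sq' h4.1 h4.2
      rw [abs_le]
      constructor <;> simp only [D] <;> nlinarith
    have e1 := k.ip_op_op_le_laplacian hδ0 hδ g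
    have e2 := k.ip_op_op_le hδ0 hδ g
    have e3 := k.ip_twist_twist_le hδ0 hδ (by positivity : 0 ≤ 2 * s) hD1
    have e4 := k.ip_twist_self_le hD2 (k.op g) (by positivity)
    set l := g - k.op g with hl
    -- The cross term is only of first order in `s` at sight. Writing `g = Pg + l`, the part with
    -- `Pg` on both sides sees only the symmetric part of `D`, of order `s²`, and the part with `l`
    -- is paid for by the loss `δ ‖l‖²` in `e1`.
    have e5 : k.ip (k.op g) (k.twist D g) =
        k.ip (k.op g) (k.twist D (k.op g)) + k.ip (k.op g) (k.twist D l) := by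
      rw [hl, twist_sub, ip_sub_right]; ring
    have e6 : 2 * k.ip (k.op g) (k.twist D l) ≤
        δ * k.ip l l + (4 / δ) * s ^ 2 * k.ip g g := by
      -- The weight `4s²/δ` in Young's inequality degenerates at `s = 0`, where `D` vanishes on the
      -- support of `a`.
      rcases hs.eq_or_lt with h0 | h0
      · have h7 := e3 l
        rw [← h0] at h7 ⊢
        have h8 := k.two_mul_ip_le one_pos (k.op g) (k.twist D l)
        have : k.twist D l = 0 := by
          ext x
          have : ∀ y, k.a x y * D x y = 0 := fun y => by
            by_contra hne
            have hd := hD1 x y (left_ne_zero_of_mul hne)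
            rw [← h0, mul_zero] at hd
            exact right_ne_zero_of_mul hne (abs_nonpos_iff.1 hd)
          simp [twist, this]
        rw [this]
        have : k.ip (k.op g) 0 = 0 := by simp [ip]
        rw [this]
        nlinarith [k.ip_self_nonneg l]
      · have h7 := k.two_mul_ip_le (by positivity : 0 < 4 * s ^ 2 / δ) (k.op g) (k.twist D l)
        have h8 := mul_le_mul_of_nonneg_left (e3 l) (by positivity : 0 ≤ 1 / (4 * s ^ 2 / δ))
        have h9 : 1 / (4 * s ^ 2 / δ) * ((2 * s) ^ 2 * k.ip l l) = δ * k.ip l l := by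
          field_simp; ring
        have h10 := mul_le_mul_of_nonneg_left e2 (by positivity : 0 ≤ 4 * s ^ 2 / δ)
        have h11 : 4 * s ^ 2 / δ * k.ip g g = (4 / δ) * s ^ 2 * k.ip g g := by ring
        linarith
    rw [hT]
    have e7 : k.ip (k.op g + k.twist D g) (k.op g + k.twist D g) =
        k.ip (k.op g) (k.op g) + 2 * k.ip (k.op g) (k.twist D g) +
          k.ip (k.twist D g) (k.twist D g) := by
      simp only [ip_add_left, ip_add_right, k.ip_comm (k.twist D g) (k.op g)]; ring
    have e8 := e3 g
    have e9 : k.ip (k.op g) (k.twist D (k.op g)) ≤ s ^ 2 * k.ip g g :=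
      e4.trans (mul_le_mul_of_nonneg_left e2 (sq_nonneg s))
    have e10 : 1 + 10 / δ * s ^ 2 ≤ Real.exp (10 / δ * s ^ 2) := he' _
    have e11 : k.ip (k.op g + k.twist D g) (k.op g + k.twist D g) ≤
        (1 + 6 * s ^ 2 + 4 / δ * s ^ 2) * k.ip g g := by
      rw [e7, e5]; linarith
    have e12 : 1 + 6 * s ^ 2 + 4 / δ * s ^ 2 ≤ 1 + 10 / δ * s ^ 2 := by
      have : 4 / δ = 4 * (1 / δ) := by ring
      rw [this, h10]; nlinarith [sq_nonneg s]
    exact e11.trans (mul_le_mul_of_nonneg_right (e12.trans e10) hg0)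
  -- For `s > 1` the crude factor `exp(2s)` suffices.
  · refine (k.ip_twist_twist_le hδ0 hδ (Real.exp_pos s).le ?_ g).trans
      (mul_le_mul_of_nonneg_right ?_ hg0)
    · intro x y h
      rw [Real.abs_exp]
      exact Real.exp_le_exp.2 ((le_abs_self _).trans (hψ x y h))
    · rw [← Real.exp_nat_mul]
      refine Real.exp_le_exp.2 ?_
      rw [h10]; push_cast
      nlinarith [mul_pos (by linarith : 0 < s) (by linarith : 0 < s)]

lemma ip_exp_iterate_le (hδ0 : 0 < δ) (hδ : δ < 1) {ψ : ι → ℝ} {s : ℝ} (hs : 0 ≤ s)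
    (hψ : ∀ x y, k.a x y ≠ 0 → |ψ x - ψ y| ≤ s) (f : ι → ℝ) (n : ℕ) :
    k.ip (fun x => Real.exp (ψ x) * k.op^[n] f x) (fun x => Real.exp (ψ x) * k.op^[n] f x) ≤
      Real.exp (10 / δ * s ^ 2 * n) *
        k.ip (fun x => Real.exp (ψ x) * f x) (fun x => Real.exp (ψ x) * f x) := by
  induction n with
  | zero => simp
  | succ n ih =>
    rw [Function.iterate_succ_apply']
    refine (k.ip_exp_op_le hδ0 hδ hs hψ _).trans ?_
    refine (mul_le_mul_of_nonneg_left ih (Real.exp_pos _).le).trans (le_of_eq ?_)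
    rw [← mul_assoc, ← Real.exp_add]
    congr 2
    push_cast; ring

end LazyKernel

end

/-! ### From Faber–Krahn to decay of the norm in one step -/

noncomputable section

namespace LazyKernel

variable {ι : Type*} [Fintype ι] {δ : ℝ} (k : LazyKernel ι δ)

/-- The Faber–Krahn inequality with parameters `C`, `α`, `F` in the sublevel set `ρ ≤ r`. -/
def FaberKrahn (ρ : ι → ℝ) (r C α F : ℝ) : Prop :=
  ∀ Ω : Finset ι, Ω.Nonempty → (∀ x ∈ Ω, ρ x ≤ r) → ∀ f : ι → ℝ, (∀ x ∉ Ω, f x = 0) →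
    C / r ^ 2 * (F / ∑ x ∈ Ω, k.π x) ^ α * k.ip f f ≤ k.dirichlet f

lemma dirichlet_le_of_abs_le {f g : ι → ℝ} (h1 : ∀ x y, |f x - f y| ≤ |g x - g y|)
    (h2 : ∀ x, |f x| ≤ |g x|) : k.dirichlet f ≤ k.dirichlet g := by
  rw [dirichlet_eq, dirichlet_eq]
  refine add_le_add (mul_le_mul_of_nonneg_left ?_ (by norm_num)) ?_
  · exact Finset.sum_le_sum fun x _ => Finset.sum_le_sum fun y _ =>
      mul_le_mul_of_nonneg_left (sq_le_sq.2 (h1 x y)) (k.a_nonneg x y)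
  · exact Finset.sum_le_sum fun x _ => mul_le_mul_of_nonneg_left (sq_le_sq.2 (h2 x))
      (sub_nonneg.2 (k.sum_le x))

/-- The Nash inequality for functions supported in a set where Faber–Krahn holds. -/
lemma FaberKrahn.nash {k : LazyKernel ι δ} {ρ : ι → ℝ} {r C α F : ℝ}
    (h : k.FaberKrahn ρ r C α F) (hC : 0 < C) (hα : 0 < α) (hF : 0 < F) {f : ι → ℝ}
    (hf : ∀ x, 0 ≤ f x) (hsupp : ∀ x, r < ρ x → f x = 0) (hmass : ∑ x, f x * k.π x ≤ 1)
    {M : ℝ} (hM : 0 < M) (hMf : M ≤ k.ip f f) :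
    C / r ^ 2 * (F * M / 4) ^ α * (M / 2) ≤ k.dirichlet f := by
  classical
  -- Faber–Krahn is applied to `(f - θ)⁺`: its support has volume at most `1/θ` by Markov's
  -- inequality, and the truncation costs at most `2θ = M/2` of the squared norm.
  set θ := M / 4 with hθ
  have hθ0 : 0 < θ := by positivity
  set g : ι → ℝ := fun x => max (f x - θ) 0 with hg
  set Ω : Finset ι := Finset.univ.filter fun x => θ < f x with hΩ
  have hgM : M / 2 ≤ k.ip g g := by
    have h1 : k.ip f f - 2 * θ * ∑ x, f x * k.π x ≤ k.ip g g := by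
      rw [ip, ip, Finset.mul_sum, ← Finset.sum_sub_distrib]
      refine Finset.sum_le_sum fun x _ => ?_
      have : f x * f x - 2 * θ * f x ≤ g x * g x := by
        rcases le_total (f x - θ) 0 with h0 | h0
        · simp only [hg, max_eq_right h0]; nlinarith [hf x]
        · simp only [hg, max_eq_left h0]; nlinarith
      nlinarith [mul_le_mul_of_nonneg_right this (k.π_pos x).le]
    nlinarith
  have hgf : k.dirichlet g ≤ k.dirichlet f := by
    refine k.dirichlet_le_of_abs_le (fun x y => ?_) fun x => ?_
    · refine (abs_max_sub_max_le_abs _ _ _).trans (le_of_eq ?_)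
      congr 1; ring
    · rw [abs_of_nonneg (le_max_right _ _), abs_of_nonneg (hf x)]
      exact max_le (by linarith) (hf x)
  have hg0 : ∀ x ∉ Ω, g x = 0 := fun x hx => by
    have : f x ≤ θ := by simpa [hΩ] using hx
    exact max_eq_right (by linarith)
  have hne : Ω.Nonempty := by
    by_contra hne
    have : ∀ x, g x = 0 := fun x => hg0 x (by simp [Finset.not_nonempty_iff_eq_empty.1 hne])
    have : k.ip g g = 0 := by simp [ip, this]
    linarith
  have hπ : 0 < ∑ x ∈ Ω, k.π x := Finset.sum_pos (fun x _ => k.π_pos x) hne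
  have hvol : (∑ x ∈ Ω, k.π x) * θ ≤ 1 := by
    refine le_trans ?_ hmass
    rw [Finset.sum_mul]
    refine (Finset.sum_le_sum fun x hx => ?_).trans (Finset.sum_le_sum_of_subset_of_nonneg
      (Finset.subset_univ Ω) fun x _ _ => mul_nonneg (hf x) (k.π_pos x).le)
    have : θ < f x := by simpa [hΩ] using hx
    nlinarith [k.π_pos x]
  have hΩr : ∀ x ∈ Ω, ρ x ≤ r := fun x hx => by
    by_contra hlt
    have h0 := hsupp x (not_le.1 hlt)
    have : θ < f x := by simpa [hΩ] using hx
    linarith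
  have key := h Ω hne hΩr g hg0
  refine le_trans ?_ (key.trans hgf)
  have h5 : F * M / 4 ≤ F / ∑ x ∈ Ω, k.π x := by
    rw [le_div_iff₀ hπ]
    calc F * M / 4 * ∑ x ∈ Ω, k.π x = F * ((∑ x ∈ Ω, k.π x) * θ) := by rw [hθ]; ring
      _ ≤ F * 1 := mul_le_mul_of_nonneg_left hvol hF.le
      _ = F := mul_one F
  gcongr

lemma dirichlet_mul_le {η f : ι → ℝ} {L : ℝ} (h0 : ∀ x, |η x| ≤ 1)
    (hη : ∀ x y, k.a x y ≠ 0 → |η x - η y| ≤ L) :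
    k.dirichlet (fun x => η x * f x) ≤ 2 * k.dirichlet f + L ^ 2 * k.ip f f := by
  have h1 : ∑ x, ∑ y, k.a x y * (η x * f x - η y * f y) ^ 2 ≤
      2 * (∑ x, ∑ y, k.a x y * (f x - f y) ^ 2) + 2 * L ^ 2 * k.ip f f := by
    have h2 : ∑ x, ∑ y, k.a x y * f y ^ 2 ≤ k.ip f f := by
      rw [k.sum_sum_mul_right (fun x => f x ^ 2)]
      exact Finset.sum_le_sum fun x _ => by
        nlinarith [mul_le_mul_of_nonneg_left (k.sum_le x) (sq_nonneg (f x))]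
    refine le_trans ?_ (add_le_add_right (mul_le_mul_of_nonneg_left h2
      (by positivity : 0 ≤ 2 * L ^ 2)) _)
    simp only [Finset.mul_sum, ← Finset.sum_add_distrib]
    refine Finset.sum_le_sum fun x _ => Finset.sum_le_sum fun y _ => ?_
    rcases eq_or_ne (k.a x y) 0 with h | h
    · simp [h]
    have hx : η x ^ 2 ≤ 1 := by rw [← sq_abs]; nlinarith [h0 x, abs_nonneg (η x)]
    have hd : (η x - η y) ^ 2 ≤ L ^ 2 := sq_le_sq' (by linarith [(abs_le.1 (hη x y h)).1])
      (abs_le.1 (hη x y h)).2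
    have h3 : (η x * f x - η y * f y) ^ 2 ≤ 2 * (f x - f y) ^ 2 + 2 * L ^ 2 * f y ^ 2 := by
      have e : η x * f x - η y * f y = η x * (f x - f y) + (η x - η y) * f y := by ring
      rw [e]
      have := add_sq_le (a := η x * (f x - f y)) (b := (η x - η y) * f y)
      nlinarith [mul_le_mul_of_nonneg_right hx (sq_nonneg (f x - f y)),
        mul_le_mul_of_nonneg_right hd (sq_nonneg (f y))]
    nlinarith [mul_le_mul_of_nonneg_left h3 (k.a_nonneg x y)]
  have h4 : ∑ x, (k.π x - ∑ y, k.a x y) * (η x * f x) ^ 2 ≤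
      2 * ∑ x, (k.π x - ∑ y, k.a x y) * f x ^ 2 := by
    rw [Finset.mul_sum]
    refine Finset.sum_le_sum fun x _ => ?_
    have hx : η x ^ 2 ≤ 1 := by rw [← sq_abs]; nlinarith [h0 x, abs_nonneg (η x)]
    have h5 : (η x * f x) ^ 2 ≤ 2 * f x ^ 2 := by
      rw [mul_pow]; nlinarith [sq_nonneg (f x)]
    nlinarith [mul_le_mul_of_nonneg_left h5 (sub_nonneg.2 (k.sum_le x))]
  rw [dirichlet_eq, dirichlet_eq k f]
  linarith

/-- One step of decay of the `L²` norm, for a function concentrated in the half ball. -/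
lemma ip_op_le_of_concentrated {ρ : ι → ℝ} {r C α F : ℝ} (hδ0 : 0 < δ) (hδ : δ < 1)
    (h : k.FaberKrahn ρ r C α F) (hr : 0 < r) (hC : 0 < C) (hα : 0 < α) (hF : 0 < F)
    (hρ : ∀ x y, k.a x y ≠ 0 → |ρ x - ρ y| ≤ 1) {q : ι → ℝ}
    (hq : ∀ x, 0 ≤ q x) (hmass : ∑ x, q x * k.π x ≤ 1) (hpos : 0 < k.ip q q)
    (htail : ∑ x, (if r / 2 < ρ x then q x * q x * k.π x else 0) ≤ k.ip q q / 2)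
    (hbig : 2 ≤ C / 16 * (F * k.ip q q / 8) ^ α) :
    k.ip (k.op q) (k.op q) ≤
      k.ip q q * (1 - 2 * δ * (C / 16 * (F * k.ip q q / 8) ^ α) / r ^ 2) := by
  -- Cutoff equal to `1` on the half ball and `0` outside the ball, with Lipschitz constant `2/r`.
  set η : ι → ℝ := fun x => max 0 (min 1 (2 - 2 * ρ x / r)) with hη
  have hη0 : ∀ x, 0 ≤ η x := fun x => le_max_left _ _
  have hη1 : ∀ x, η x ≤ 1 := fun x => max_le zero_le_one (min_le_left _ _)
  have hηL : ∀ x y, k.a x y ≠ 0 → |η x - η y| ≤ 2 / r := fun x y hxy => by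
    have h1 : |η x - η y| ≤ |(2 - 2 * ρ x / r) - (2 - 2 * ρ y / r)| := by
      have e1 := abs_max_sub_max_le_abs (min 1 (2 - 2 * ρ x / r)) (min 1 (2 - 2 * ρ y / r)) 0
      have e2 := abs_min_sub_min_le_max 1 (2 - 2 * ρ x / r) 1 (2 - 2 * ρ y / r)
      simp only [sub_self, abs_zero] at e2
      rw [max_eq_right (abs_nonneg _)] at e2
      simp only [hη, max_comm (0 : ℝ)]
      exact e1.trans e2
    refine h1.trans ?_
    have e : (2 - 2 * ρ x / r) - (2 - 2 * ρ y / r) = -(2 / r * (ρ x - ρ y)) := by ring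
    rw [e, abs_neg, abs_mul, abs_of_pos (by positivity : 0 < 2 / r)]
    nlinarith [hρ x y hxy, (by positivity : 0 < 2 / r)]
  set f : ι → ℝ := fun x => η x * q x with hf
  have hfq : k.ip q q / 2 ≤ k.ip f f := by
    have : k.ip q q ≤ k.ip f f +
        ∑ x, (if r / 2 < ρ x then q x * q x * k.π x else 0) := by
      rw [ip, ip, ← Finset.sum_add_distrib]
      refine Finset.sum_le_sum fun x _ => ?_
      have hfx : 0 ≤ f x * f x * k.π x := mul_nonneg (mul_self_nonneg _) (k.π_pos x).le
      split_ifs with hx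
      · linarith
      · have : η x = 1 := by
          have : 1 ≤ 2 - 2 * ρ x / r := by
            have : 2 * ρ x / r ≤ 1 := by rw [div_le_one hr]; linarith [not_lt.1 hx]
            linarith
          simp [hη, min_eq_left this]
        simp [hf, this]
    linarith
  have hN := h.nash hC hα hF (f := f) (fun x => mul_nonneg (hη0 x) (hq x)) (fun x hx => by
      have : 2 - 2 * ρ x / r ≤ 0 := by
        have : 2 ≤ 2 * ρ x / r := by rw [le_div_iff₀ hr]; linarith
        linarith
      have : η x = 0 := by
        simp only [hη]
        exact max_eq_left ((min_le_right _ _).trans this)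
      simp [hf, this])
    ((Finset.sum_le_sum fun x _ => by
      refine mul_le_mul_of_nonneg_right ?_ (k.π_pos x).le
      simp only [hf]; nlinarith [hη1 x, hq x]).trans hmass) (half_pos hpos) hfq
  have hD := k.dirichlet_mul_le (η := η) (f := q) (L := 2 / r)
    (fun x => by rw [abs_of_nonneg (hη0 x)]; exact hη1 x) hηL
  have hS := k.ip_op_op_le_dirichlet hδ q
  set M := k.ip q q with hM
  have e1 : F * (M / 2) / 4 = F * M / 8 := by ring
  rw [e1] at hN
  set Y := (F * M / 8) ^ α with hY
  have hr2 : 0 < r ^ 2 := by positivity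
  have e2 : M * (C / 16 * Y) / r ^ 2 ≤ k.dirichlet q := by
    have h1 := hN.trans hD
    have h2 : (2 / r) ^ 2 * M = 4 * M / r ^ 2 := by rw [div_pow]; ring
    have h3 : C / r ^ 2 * Y * (M / 2 / 2) = C * Y * M / 4 / r ^ 2 := by ring
    rw [h2, h3] at h1
    -- `hbig` makes the cutoff error at most half of the Nash term.
    have h4 : M * (C / 16 * Y) / r ^ 2 ≤ (C * Y * M / 8 - 2 * M) / r ^ 2 := by
      refine div_le_div_of_nonneg_right ?_ hr2.le
      nlinarith
    have h5 : (C * Y * M / 8 - 2 * M) / r ^ 2 =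
      (C * Y * M / 4 / r ^ 2 - 4 * M / r ^ 2) / 2 := by ring
    linarith
  refine hS.trans ?_
  have e3 : M * (1 - 2 * δ * (C / 16 * Y) / r ^ 2) =
    M - 2 * δ * (M * (C / 16 * Y) / r ^ 2) := by ring
  rw [e3]
  nlinarith

/-! ### Weighted norms and the density of the walk -/

lemma sum_op_mul_le {q : ι → ℝ} (hq : ∀ x, 0 ≤ q x) :
    ∑ x, k.op q x * k.π x ≤ ∑ x, q x * k.π x := by
  have h1 : ∑ x, k.op q x * k.π x = ∑ x, ∑ y, k.a x y * q y :=
    Finset.sum_congr rfl fun x _ => div_mul_cancel₀ _ (k.π_pos x).ne'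
  rw [h1, sum_sum_mul_right]
  exact Finset.sum_le_sum fun x _ => mul_le_mul_of_nonneg_left (k.sum_le x) (hq x)

/-- The density with respect to `π` of the walk started at `x₀`, after `n` steps. -/
def density [DecidableEq ι] (x₀ : ι) (n : ℕ) : ι → ℝ :=
  k.op^[n] (Pi.single x₀ (1 / k.π x₀))

/-- The squared norm of `f` in `L²(exp (2sρ) π)`. -/
def weightedNormSq (ρ : ι → ℝ) (s : ℝ) (f : ι → ℝ) : ℝ :=
  k.ip (fun x => Real.exp (s * ρ x) * f x) (fun x => Real.exp (s * ρ x) * f x)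

lemma weightedNormSq_eq (ρ : ι → ℝ) (s : ℝ) (f : ι → ℝ) :
    k.weightedNormSq ρ s f = ∑ x, Real.exp (2 * s * ρ x) * (f x * f x * k.π x) := by
  refine Finset.sum_congr rfl fun x _ => ?_
  have : Real.exp (2 * s * ρ x) = Real.exp (s * ρ x) * Real.exp (s * ρ x) := by
    rw [← Real.exp_add]; ring_nf
  rw [this]; ring

lemma mul_self_mul_nonneg (f : ι → ℝ) (x : ι) : 0 ≤ f x * f x * k.π x :=
  mul_nonneg (mul_self_nonneg _) (k.π_pos x).le

lemma weightedNormSq_mono {ρ : ι → ℝ} (hρ : ∀ x, 0 ≤ ρ x) {s t : ℝ} (h : s ≤ t) (f : ι → ℝ) :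
    k.weightedNormSq ρ s f ≤ k.weightedNormSq ρ t f := by
  rw [weightedNormSq_eq, weightedNormSq_eq]
  refine Finset.sum_le_sum fun x _ => mul_le_mul_of_nonneg_right (Real.exp_le_exp.2 ?_)
    (k.mul_self_mul_nonneg f x)
  nlinarith [hρ x]

/-- Pointwise `v³ ≤ X³ + v⁴/X`, by comparing `v` with `X`. The small factor `1/X` on the stronger
weighted norm is what lets the induction in `density_bounds` reproduce its own constant. -/
lemma weightedNormSq_interpolate {ρ : ι → ℝ} (hρ : ∀ x, 0 ≤ ρ x) {s t X : ℝ} (hX : 0 < X)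
    (h : s ≤ 3 / 4 * t) (f : ι → ℝ) :
    k.weightedNormSq ρ s f ≤ X ^ 3 * k.ip f f + 1 / X * k.weightedNormSq ρ t f := by
  rw [weightedNormSq_eq, weightedNormSq_eq, ip, Finset.mul_sum, Finset.mul_sum,
    ← Finset.sum_add_distrib]
  refine Finset.sum_le_sum fun x _ => ?_
  rw [← mul_assoc (1 / X), ← add_mul]
  refine mul_le_mul_of_nonneg_right ?_ (k.mul_self_mul_nonneg f x)
  set v := Real.exp (t * ρ x / 2) with hv
  have hv0 : 0 < v := Real.exp_pos _
  have h1 : Real.exp (2 * s * ρ x) ≤ v ^ 3 := by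
    rw [hv, ← Real.exp_nat_mul]
    refine Real.exp_le_exp.2 ?_
    push_cast
    nlinarith [mul_le_mul_of_nonneg_right h (hρ x)]
  have h2 : Real.exp (2 * t * ρ x) = v ^ 4 := by
    rw [hv, ← Real.exp_nat_mul]; congr 1; push_cast; ring
  rw [h2]
  refine h1.trans ?_
  rcases le_total v X with hvX | hvX
  · have : v ^ 3 ≤ X ^ 3 := by gcongr
    have : 0 ≤ 1 / X * v ^ 4 := by positivity
    linarith
  · have : v ^ 3 ≤ 1 / X * v ^ 4 := by
      rw [one_div, inv_mul_eq_div, le_div_iff₀ hX]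
      nlinarith [pow_pos hv0 3]
    have : 0 ≤ X ^ 3 := by positivity
    linarith

lemma weightedNormSq_iterate_le (hδ0 : 0 < δ) (hδ : δ < 1) {ρ : ι → ℝ}
    (hρ : ∀ x y, k.a x y ≠ 0 → |ρ x - ρ y| ≤ 1) {s : ℝ} (hs : 0 ≤ s) (f : ι → ℝ) (n : ℕ) :
    k.weightedNormSq ρ s (k.op^[n] f) ≤
      Real.exp (10 / δ * s ^ 2 * n) * k.weightedNormSq ρ s f := by
  refine k.ip_exp_iterate_le hδ0 hδ (ψ := fun x => s * ρ x) hs (fun x y h => ?_) f n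
  rw [← mul_sub, abs_mul, abs_of_nonneg hs]
  nlinarith [hρ x y h]

lemma tail_le_weightedNormSq {ρ : ι → ℝ} {r s : ℝ} (hs : 0 ≤ s) (f : ι → ℝ) :
    ∑ x, (if r / 2 < ρ x then f x * f x * k.π x else 0) ≤
      Real.exp (-(s * r)) * k.weightedNormSq ρ s f := by
  rw [weightedNormSq_eq, Finset.mul_sum]
  refine Finset.sum_le_sum fun x _ => ?_
  have h0 := k.mul_self_mul_nonneg f x
  rw [← mul_assoc, ← Real.exp_add]
  split_ifs with h
  · refine le_mul_of_one_le_left h0 (Real.one_le_exp ?_)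
    nlinarith
  · positivity

lemma ip_op_left (f g : ι → ℝ) : k.ip (k.op f) g = k.ip f (k.op g) := by
  rw [ip_comm, ip_op, ip_op, form_comm]

lemma ip_iterate_left (n : ℕ) (f g : ι → ℝ) : k.ip (k.op^[n] f) g = k.ip f (k.op^[n] g) := by
  induction n generalizing g with
  | zero => rfl
  | succ n ih =>
    rw [Function.iterate_succ_apply', ip_op_left, ih, Function.iterate_succ_apply]

section density

variable [DecidableEq ι] (x₀ : ι)

lemma density_zero : k.density x₀ 0 = Pi.single x₀ (1 / k.π x₀) := rfl

lemma density_succ (n : ℕ) : k.density x₀ (n + 1) = k.op (k.density x₀ n) :=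
  Function.iterate_succ_apply' _ _ _

lemma density_add (m n : ℕ) : k.density x₀ (m + n) = k.op^[m] (k.density x₀ n) :=
  Function.iterate_add_apply _ _ _ _

lemma density_nonneg (n : ℕ) (x : ι) : 0 ≤ k.density x₀ n x := by
  induction n generalizing x with
  | zero =>
    rw [density_zero, Pi.single_apply]
    split_ifs
    · exact (one_div_pos.2 (k.π_pos _)).le
    · exact le_rfl
  | succ n ih => rw [density_succ]; exact k.op_nonneg ih x

lemma sum_density_mul_le (n : ℕ) : ∑ x, k.density x₀ n x * k.π x ≤ 1 := by
  induction n with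
  | zero =>
    simp [density_zero, Pi.single_apply, (k.π_pos x₀).ne']
  | succ n ih =>
    rw [density_succ]
    exact (k.sum_op_mul_le (k.density_nonneg x₀ n)).trans ih

lemma ip_single (f : ι → ℝ) : k.ip (Pi.single x₀ (1 / k.π x₀)) f = f x₀ := by
  have := (k.π_pos x₀).ne'
  simp [ip, Pi.single_apply]
  field_simp

lemma weightedNormSq_density_zero {ρ : ι → ℝ} (hρ : ρ x₀ = 0) (s : ℝ) :
    k.weightedNormSq ρ s (k.density x₀ 0) = 1 / k.π x₀ := by
  have := (k.π_pos x₀).ne'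
  rw [weightedNormSq_eq]
  simp [density_zero, Pi.single_apply, hρ]
  field_simp

lemma ip_density_zero : k.ip (k.density x₀ 0) (k.density x₀ 0) = 1 / k.π x₀ := by
  rw [density_zero, ip_single, Pi.single_eq_same]

lemma density_add_apply (x y : ι) (m n : ℕ) :
    k.density y (m + n) x = k.ip (k.density x m) (k.density y n) := by
  rw [density_add, density.eq_def k x, ip_iterate_left, ip_single]

/-- Base of the induction: Faber–Krahn on the singleton `{x₀}` against the upper bound `2` for the
Rayleigh quotient. -/
lemma one_div_le_of_faberKrahn {k : LazyKernel ι δ} {x₀ : ι} {ρ : ι → ℝ} {r C α F : ℝ}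
    (hδ0 : 0 < δ) (h : k.FaberKrahn ρ r C α F) (hr : 0 < r) (hC : 0 < C)
    (hα : 0 < α) (hF : 0 < F) (hρ : ρ x₀ = 0) :
    1 / k.π x₀ ≤ (2 / C * r ^ 2) ^ (1 / α) / F := by
  have hπ := k.π_pos x₀
  have h1 := h {x₀} (by simp) (by simpa [hρ] using hr.le) (Pi.single x₀ (1 / k.π x₀))
    (fun x hx => by simp [Pi.single_apply] at hx ⊢; intro h'; exact absurd h' hx)
  have h2 := k.dirichlet_le (Pi.single x₀ (1 / k.π x₀))
  have h3 := k.ip_density_zero x₀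
  rw [density_zero] at h3
  rw [h3, Finset.sum_singleton] at h1
  rw [h3] at h2
  have h4 : 0 < 1 / k.π x₀ := by positivity
  have h5 : C / r ^ 2 * (F / k.π x₀) ^ α ≤ 2 := by
    have : C / r ^ 2 * (F / k.π x₀) ^ α * (1 / k.π x₀) ≤ (2 - 2 * δ) * (1 / k.π x₀) :=
      h1.trans h2
    have := le_of_mul_le_mul_right this h4
    linarith
  have h6 : (F / k.π x₀) ^ α ≤ 2 / C * r ^ 2 := by
    have e : 2 / C * r ^ 2 = 2 / (C / r ^ 2) := by field_simp
    rw [e, le_div_iff₀ (by positivity)]; linarith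
  rw [le_div_iff₀ hF]
  have h7 := Real.rpow_le_rpow (by positivity) h6 (by positivity : 0 ≤ 1 / α)
  rw [← Real.rpow_mul (by positivity), mul_one_div_cancel hα.ne', Real.rpow_one] at h7
  calc 1 / k.π x₀ * F = F / k.π x₀ := by ring
    _ ≤ _ := h7

end density

end LazyKernel

end

/-! ### Joint induction for the norm and the weighted norm -/

noncomputable section

/-- Bernoulli's inequality for `p ≥ 1` and `1 - x ≤ (1 - x) ^ p` for `p ≤ 1`; the constant `1 + p`
covers both. -/
lemma Real.one_sub_mul_le_rpow {p x : ℝ} (hp : 0 < p) (hx0 : 0 ≤ x) (hx1 : x ≤ 1) :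
    1 - (1 + p) * x ≤ (1 - x) ^ p := by
  rcases le_total 1 p with h | h
  · have := one_add_mul_self_le_rpow_one_add (s := -x) (by linarith) h
    rw [← sub_eq_add_neg] at this
    nlinarith
  · have := Real.rpow_le_rpow_of_exponent_ge' (by linarith : 0 ≤ 1 - x) (by linarith) hp.le h
    rw [Real.rpow_one] at this
    nlinarith [mul_nonneg hp.le hx0]

namespace LazyKernel

variable {ι : Type*} [Fintype ι] {δ : ℝ} (k : LazyKernel ι δ) [DecidableEq ι]

/-- The bound `8 (B r² / (t + 1)) ^ (1 / α) / F` for the squared norm of the density at time `t`. -/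
def decayBound (B α r F : ℝ) (t : ℕ) : ℝ :=
  8 * (B * (r ^ 2 / (t + 1))) ^ (1 / α) / F

lemma decayBound_pos {B α r F : ℝ} (hB : 0 < B) (hr : 0 < r) (hF : 0 < F) (t : ℕ) :
    0 < decayBound B α r F t := by
  unfold decayBound; positivity

lemma decayBound_le_mul {B α r F c : ℝ} (hB : 0 < B) (hα : 0 < α) (hr : 0 < r) (hF : 0 < F)
    (hc : 0 < c) {s t : ℕ} (h : (t + 1 : ℝ) ≤ c * (s + 1)) :
    decayBound B α r F s ≤ c ^ (1 / α) * decayBound B α r F t := by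
  unfold decayBound
  have h1 : (B * (r ^ 2 / (s + 1))) ^ (1 / α) ≤
      c ^ (1 / α) * (B * (r ^ 2 / (t + 1))) ^ (1 / α) := by
    rw [← Real.mul_rpow hc.le (by positivity)]
    refine Real.rpow_le_rpow (by positivity) ?_ (by positivity)
    have : r ^ 2 / (s + 1) ≤ c * (r ^ 2 / (t + 1)) := by
      rw [← mul_div_assoc, div_le_div_iff₀ (by positivity) (by positivity)]
      nlinarith [mul_le_mul_of_nonneg_left h (sq_nonneg r)]
    nlinarith
  have h2 : 8 * (B * (r ^ 2 / (s + 1))) ^ (1 / α) ≤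
      c ^ (1 / α) * (8 * (B * (r ^ 2 / (t + 1))) ^ (1 / α)) := by linarith
  rw [← mul_div_assoc (c ^ (1 / α))]
  exact div_le_div_of_nonneg_right h2 hF.le

lemma decayBound_succ {B α r F : ℝ} (hB : 0 < B) (hr : 0 < r) (t : ℕ) :
    decayBound B α r F t * (1 - 1 / ((t : ℝ) + 2)) ^ (1 / α) = decayBound B α r F (t + 1) := by
  unfold decayBound
  have h2 : (1 : ℝ) - 1 / ((t : ℝ) + 2) = ((t : ℝ) + 1) / (t + 2) := by
    field_simp; ring
  have h3 : (B * (r ^ 2 / (((t + 1 : ℕ) : ℝ) + 1))) ^ (1 / α) =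
      (B * (r ^ 2 / (t + 1))) ^ (1 / α) * (((t : ℝ) + 1) / (t + 2)) ^ (1 / α) := by
    rw [← Real.mul_rpow (by positivity) (by positivity)]
    congr 1
    push_cast
    field_simp
    ring
  rw [h2, h3]; ring

/-- The factor `8` in `decayBound` matches the one in `ip_op_le_of_concentrated`, so the decay rate
becomes a multiple of `1/(t + 1)`. -/
lemma mul_decayBound_rpow {B α r F : ℝ} (hB : 0 < B) (hα : 0 < α) (hF : 0 < F) (t : ℕ) :
    (F * decayBound B α r F t / 8) ^ α = B * (r ^ 2 / (t + 1)) := by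
  have h : F * decayBound B α r F t / 8 = (B * (r ^ 2 / (t + 1))) ^ (1 / α) := by
    unfold decayBound; field_simp
  rw [h, ← Real.rpow_mul (by positivity), one_div_mul_cancel hα.ne', Real.rpow_one]

/-- Through `D ≤ exp D`, the polynomial loss from stopping at an early time becomes exponential and
can enter the Gaussian exponent. -/
lemma decayBound_le_exp {B α r F D : ℝ} (hB : 0 < B) (hα : 0 < α) (hr : 0 < r) (hF : 0 < F)
    {t : ℕ} (h : r ^ 2 / (t + 1) ≤ 2 * D) :
    decayBound B α r F t ≤ 8 * ((B * 2) ^ (1 / α) * Real.exp (D / α)) / F := by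
  have e : Real.exp (D / α) = Real.exp D ^ (1 / α) := by
    rw [← Real.exp_mul]; congr 1; ring
  have h3 : D ≤ Real.exp D := by linarith [Real.add_one_le_exp D]
  have h4 : B * (r ^ 2 / (t + 1)) ≤ B * 2 * Real.exp D := by
    rw [mul_assoc]
    exact mul_le_mul_of_nonneg_left (by linarith) hB.le
  unfold decayBound
  rw [e, ← Real.mul_rpow (by positivity) (by positivity)]
  refine div_le_div_of_nonneg_right (mul_le_mul_of_nonneg_left ?_ (by norm_num)) hF.le
  exact Real.rpow_le_rpow (by positivity) h4 (by positivity)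

variable {k} {x₀ : ι} {ρ : ι → ℝ} {r C α F : ℝ}

/-- On-diagonal decay propagates one step in time, when the mass is concentrated near `x₀`. -/
lemma ip_density_succ_le (hδ0 : 0 < δ) (hδ : δ < 1)
    (h : k.FaberKrahn ρ r C α F) (hr : 0 < r) (hC : 0 < C) (hα : 0 < α) (hF : 0 < F)
    (hρ : ∀ x y, k.a x y ≠ 0 → |ρ x - ρ y| ≤ 1)
    {B : ℝ} (hB : 0 < B) (hB1 : 32 ≤ C * B) (hB2 : 8 * (1 + 1 / α) ≤ δ * C * B)
    {K y : ℝ} (hK : 0 < K) (hy2 : 2 ≤ y) (hy : 2 * K * 2 ^ (1 / α) ≤ y) {t : ℕ}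
    (ht : ((t : ℝ) + 1) * y ^ 2 ≤ r ^ 2)
    (hM : k.ip (k.density x₀ t) (k.density x₀ t) ≤ decayBound B α r F t)
    (hW : k.weightedNormSq ρ (1 / √((t : ℝ) + 1)) (k.density x₀ t) ≤
      K * decayBound B α r F t) :
    k.ip (k.density x₀ (t + 1)) (k.density x₀ (t + 1)) ≤ decayBound B α r F (t + 1) := by
  rw [density_succ]
  set q := k.density x₀ t with hq
  set b := decayBound B α r F with hb
  have hbpos : ∀ t, 0 < b t := decayBound_pos hB hr hF
  -- If the norm is already below the next bound, contraction suffices. Otherwise it is bounded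
  -- below, which makes both the relative tail small and the Nash rate explicit.
  by_cases hsmall : k.ip q q ≤ b (t + 1)
  · exact (k.ip_op_op_le hδ0 hδ q).trans hsmall
  push Not at hsmall
  have hpos : 0 < k.ip q q := (hbpos _).trans hsmall
  have hy0 : 0 < y := by linarith
  have htail : ∑ x, (if r / 2 < ρ x then q x * q x * k.π x else 0) ≤ k.ip q q / 2 := by
    have hsq : 0 < √((t : ℝ) + 1) := by positivity
    have h1 := k.tail_le_weightedNormSq (ρ := ρ) (r := r)
      (by positivity : 0 ≤ 1 / √((t : ℝ) + 1)) q
    have h2 : y ≤ 1 / √((t : ℝ) + 1) * r := by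
      rw [one_div, inv_mul_eq_div, le_div_iff₀ hsq]
      refine le_of_sq_le_sq ?_ hr.le
      rw [mul_pow, Real.sq_sqrt (by positivity)]; linarith
    have h3 : Real.exp (-(1 / √((t : ℝ) + 1) * r)) ≤ 1 / y := by
      rw [Real.exp_neg, one_div y]
      refine inv_anti₀ hy0 ?_
      have := Real.add_one_le_exp (1 / √((t : ℝ) + 1) * r)
      linarith
    have h4 : b t ≤ 2 ^ (1 / α) * b (t + 1) :=
      decayBound_le_mul hB hα hr hF two_pos (by push_cast; linarith [t.cast_nonneg (α := ℝ)])
    refine h1.trans ?_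
    have h5 : 1 / y * (K * b t) ≤ b (t + 1) / 2 := by
      rw [one_div, inv_mul_eq_div, div_le_iff₀ hy0]
      nlinarith [mul_le_mul_of_nonneg_left h4 hK.le,
        mul_le_mul_of_nonneg_right hy (hbpos (t + 1)).le]
    calc _ ≤ 1 / y * (K * b t) :=
          mul_le_mul h3 hW (k.ip_self_nonneg _) (by positivity)
      _ ≤ b (t + 1) / 2 := h5
      _ ≤ _ := by linarith
  have hr2 : (0 : ℝ) < r ^ 2 := by positivity
  have ht2 : (t : ℝ) + 2 ≤ r ^ 2 := by
    have : (4 : ℝ) ≤ y ^ 2 := by nlinarith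
    nlinarith [t.cast_nonneg (α := ℝ)]
  have htp : (0 : ℝ) < (t : ℝ) + 2 := by positivity
  have hY : B * (r ^ 2 / ((t : ℝ) + 2)) ≤ (F * k.ip q q / 8) ^ α := by
    have := mul_decayBound_rpow (r := r) hB hα hF (t + 1)
    have e : (((t + 1 : ℕ) : ℝ) + 1) = (t : ℝ) + 2 := by push_cast; ring
    rw [e] at this
    rw [← this]
    have := hbpos (t + 1)
    exact Real.rpow_le_rpow (by positivity) (by gcongr) hα.le
  set Y := (F * k.ip q q / 8) ^ α
  have hbig : 2 ≤ C / 16 * Y := by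
    have h1 : (1 : ℝ) ≤ r ^ 2 / ((t : ℝ) + 2) := by rwa [one_le_div htp]
    have h2 : C / 16 * B ≤ C / 16 * Y :=
      mul_le_mul_of_nonneg_left (by nlinarith) (by positivity)
    linarith
  refine (k.ip_op_le_of_concentrated hδ0 hδ h hr hC hα hF hρ (k.density_nonneg x₀ t)
    (k.sum_density_mul_le x₀ t) hpos htail hbig).trans ?_
  -- By `hB2` the rate is at least `(1 + 1/α)/(t + 2)`, enough to follow the ratio of consecutive
  -- bounds.
  have hfac : 1 - 2 * δ * (C / 16 * Y) / r ^ 2 ≤ (1 - 1 / ((t : ℝ) + 2)) ^ (1 / α) := by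
    refine le_trans ?_ (Real.one_sub_mul_le_rpow (by positivity) (by positivity)
      (by rw [div_le_one htp]; linarith [t.cast_nonneg (α := ℝ)]))
    have h1 : 2 * δ * (C / 16) * (B * (r ^ 2 / ((t : ℝ) + 2))) / r ^ 2 ≤
        2 * δ * (C / 16 * Y) / r ^ 2 := by
      refine div_le_div_of_nonneg_right ?_ hr2.le
      nlinarith [mul_le_mul_of_nonneg_left hY (by positivity : 0 ≤ 2 * δ * (C / 16))]
    have h2 : 2 * δ * (C / 16) * (B * (r ^ 2 / ((t : ℝ) + 2))) / r ^ 2 =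
        δ * C * B / 8 * (1 / ((t : ℝ) + 2)) := by field_simp; ring
    have h3 := mul_le_mul_of_nonneg_right hB2 (by positivity : 0 ≤ 1 / ((t : ℝ) + 2))
    linarith
  rw [hb, ← decayBound_succ hB hr t, ← hb]
  have ht0 : (0 : ℝ) ≤ 1 - 1 / ((t : ℝ) + 2) := by
    rw [sub_nonneg, div_le_one htp]; linarith [t.cast_nonneg (α := ℝ)]
  exact (mul_le_mul_of_nonneg_left hfac hpos.le).trans
    (mul_le_mul_of_nonneg_right hM (Real.rpow_nonneg ht0 _))

/-- The norm bound at `t + 1` uses both bounds at `t`; the weighted bound at `t + 1` uses both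
bounds near half that time, by interpolation and Davies' estimate. The constant `X ^ 4` closes
because `2 X³ exp(10/δ) 3^(1/α) ≤ X⁴`, and `y` is taken large in terms of `X`. -/
lemma density_bounds (hδ0 : 0 < δ) (hδ : δ < 1)
    (h : k.FaberKrahn ρ r C α F) (hr : 0 < r) (hC : 0 < C) (hα : 0 < α) (hF : 0 < F)
    (hρ0 : ∀ x, 0 ≤ ρ x) (hρx : ρ x₀ = 0) (hρ : ∀ x y, k.a x y ≠ 0 → |ρ x - ρ y| ≤ 1)
    {B : ℝ} (hB : 0 < B) (hB1 : 32 ≤ C * B) (hB2 : 8 * (1 + 1 / α) ≤ δ * C * B)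
    {X y : ℝ} (hX : 2 * Real.exp (10 / δ) * 3 ^ (1 / α) ≤ X)
    (hy2 : 2 ≤ y) (hy : 2 * X ^ 4 * 2 ^ (1 / α) ≤ y) (t : ℕ) (ht : (t : ℝ) * y ^ 2 ≤ r ^ 2) :
    k.ip (k.density x₀ t) (k.density x₀ t) ≤ decayBound B α r F t ∧
    k.weightedNormSq ρ (1 / √((t : ℝ) + 1)) (k.density x₀ t) ≤
      X ^ 4 * decayBound B α r F t := by
  have hX1 : 1 ≤ X := by
    have h1 : 1 ≤ Real.exp (10 / δ) := Real.one_le_exp (by positivity)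
    have h2 : (1 : ℝ) ≤ 3 ^ (1 / α) := Real.one_le_rpow (by norm_num) (by positivity)
    nlinarith
  have hX0 : 0 < X := by linarith
  have hX4 : 1 ≤ X ^ 4 := one_le_pow₀ hX1
  induction t using Nat.strong_induction_on with
  | _ t ih =>
  rcases t with _ | t
  · have h1 : 1 / k.π x₀ ≤ decayBound B α r F 0 := by
      refine (one_div_le_of_faberKrahn hδ0 h hr hC hα hF hρx).trans ?_
      unfold decayBound
      refine div_le_div_of_nonneg_right ?_ hF.le
      have h2 : (2 / C * r ^ 2) ^ (1 / α) ≤ (B * (r ^ 2 / ((0 : ℕ) + 1))) ^ (1 / α) := by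
        refine Real.rpow_le_rpow (by positivity) ?_ (by positivity)
        have : 2 / C ≤ B := by rw [div_le_iff₀ hC]; linarith
        simp only [Nat.cast_zero, zero_add, div_one]
        gcongr
      have h3 : 0 ≤ (B * (r ^ 2 / ((0 : ℕ) + 1))) ^ (1 / α) := by positivity
      linarith
    rw [weightedNormSq_density_zero _ _ hρx, ip_density_zero]
    have := decayBound_pos (α := α) hB hr hF 0
    exact ⟨h1, by nlinarith⟩
  · have hy0 : 0 < y ^ 2 := by positivity
    have hle : ∀ s : ℕ, s < t + 1 → (s : ℝ) * y ^ 2 ≤ r ^ 2 := fun s hs =>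
      (mul_le_mul_of_nonneg_right (Nat.cast_le.2 hs.le) hy0.le).trans ht
    have hP := ih t (Nat.lt_succ_self t) (hle t (Nat.lt_succ_self t))
    refine ⟨ip_density_succ_le hδ0 hδ h hr hC hα hF hρ hB hB1 hB2 (by positivity) hy2 hy
      (by simpa using ht) hP.1 hP.2, ?_⟩
    -- Then `2(s + 1) ≤ t + 2 ≤ 3(s + 1)`: the first inequality gives the exponent ratio `3/4`
    -- needed to interpolate, as `1/√2 ≤ 3/4`, and the second the loss `3^(1/α)`.
    obtain ⟨s, hs⟩ : ∃ s, s + 1 = (t + 2) / 2 := ⟨(t + 2) / 2 - 1, by omega⟩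
    have hst : s < t + 1 := by omega
    obtain ⟨hM, hW⟩ := ih s hst (hle s hst)
    have h2s : (2 : ℝ) * (s + 1) ≤ t + 2 := by
      have : 2 * (s + 1) ≤ t + 2 := by omega
      exact_mod_cast this
    have h3s : (t : ℝ) + 2 ≤ 3 * (s + 1) := by
      have : t + 2 ≤ 3 * (s + 1) := by omega
      exact_mod_cast this
    have hb0 := decayBound_pos (α := α) hB hr hF s
    have hcast : (((t + 1 : ℕ) : ℝ) + 1) = (t : ℝ) + 2 := by push_cast; ring
    rw [hcast]
    set σ := 1 / √((t : ℝ) + 2) with hσ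
    have hσ0 : 0 ≤ σ := by positivity
    have hσ2 : σ ^ 2 = 1 / ((t : ℝ) + 2) := by
      rw [hσ, div_pow, Real.sq_sqrt (by positivity), one_pow]
    have hσs : σ ≤ 3 / 4 * (1 / √((s : ℝ) + 1)) := by
      refine le_of_sq_le_sq ?_ (by positivity)
      rw [hσ2, mul_pow, div_pow 1, Real.sq_sqrt (by positivity), one_pow]
      rw [mul_one_div, div_le_div_iff₀ (by positivity) (by positivity)]
      linarith
    obtain ⟨m, hm⟩ : ∃ m, t + 1 = m + s := ⟨t + 1 - s, by omega⟩
    have hmt : (m : ℝ) ≤ (t : ℝ) + 2 := by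
      have : m ≤ t + 2 := by omega
      exact_mod_cast this
    have e1 := k.weightedNormSq_iterate_le hδ0 hδ hρ hσ0 (k.density x₀ s) m
    rw [← density_add, ← hm] at e1
    have e2 : Real.exp (10 / δ * σ ^ 2 * m) ≤ Real.exp (10 / δ) := by
      refine Real.exp_le_exp.2 ?_
      rw [hσ2, mul_assoc]
      refine mul_le_of_le_one_right (by positivity) ?_
      rw [one_div, inv_mul_eq_div, div_le_one (by positivity)]
      exact hmt
    have e3 := k.weightedNormSq_interpolate hρ0 hX0 hσs (k.density x₀ s)
    have e4 : k.weightedNormSq ρ σ (k.density x₀ s) ≤ 2 * X ^ 3 * decayBound B α r F s := by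
      have h1 := mul_le_mul_of_nonneg_left hM (by positivity : 0 ≤ X ^ 3)
      have h2 := mul_le_mul_of_nonneg_left hW (by positivity : 0 ≤ 1 / X)
      have h3 : 1 / X * (X ^ 4 * decayBound B α r F s) = X ^ 3 * decayBound B α r F s := by
        field_simp
      linarith
    have e5 : decayBound B α r F s ≤ 3 ^ (1 / α) * decayBound B α r F (t + 1) :=
      decayBound_le_mul hB hα hr hF (by norm_num) (by rw [hcast]; exact h3s)
    have hb1 := decayBound_pos (α := α) hB hr hF (t + 1)
    calc _ ≤ Real.exp (10 / δ) * (2 * X ^ 3 * decayBound B α r F s) :=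
          e1.trans (mul_le_mul e2 e4 (k.ip_self_nonneg _) (Real.exp_pos _).le)
      _ ≤ Real.exp (10 / δ) * (2 * X ^ 3 * (3 ^ (1 / α) * decayBound B α r F (t + 1))) := by
          gcongr
      _ = (2 * Real.exp (10 / δ) * 3 ^ (1 / α)) * (X ^ 3 * decayBound B α r F (t + 1)) := by
          ring
      _ ≤ X * (X ^ 3 * decayBound B α r F (t + 1)) := by gcongr
      _ = _ := by ring

/-- Weighted `L²` bound for the density at times comparable with `N = r²`. -/
lemma weightedNormSq_density_le (hδ0 : 0 < δ) (hδ : δ < 1) {N : ℕ} (hN : 0 < N)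
    (h : k.FaberKrahn ρ (√N) C α F) (hC : 0 < C) (hα : 0 < α) (hF : 0 < F)
    (hρ0 : ∀ x, 0 ≤ ρ x) (hρx : ρ x₀ = 0) (hρ : ∀ x y, k.a x y ≠ 0 → |ρ x - ρ y| ≤ 1)
    {B : ℝ} (hB : 0 < B) (hB1 : 32 ≤ C * B) (hB2 : 8 * (1 + 1 / α) ≤ δ * C * B)
    {X y : ℝ} (hX : 2 * Real.exp (10 / δ) * 3 ^ (1 / α) ≤ X)
    (hy2 : 2 ≤ y) (hy : 2 * X ^ 4 * 2 ^ (1 / α) ≤ y) {s : ℝ} (hs : 0 ≤ s) {n : ℕ}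
    (hn : N / 2 ≤ n) (hnN : n ≤ N) :
    k.weightedNormSq ρ s (k.density x₀ n) ≤
      8 * X ^ 4 * (B * 2) ^ (1 / α) * Real.exp (y ^ 2 / α) / F *
        Real.exp ((10 / δ + 1 / α) * (s ^ 2 * N)) := by
  have hNr : (0 : ℝ) < N := Nat.cast_pos.2 hN
  have hr : 0 < √(N : ℝ) := Real.sqrt_pos.2 hNr
  have hr2 : √(N : ℝ) ^ 2 = N := Real.sq_sqrt hNr.le
  have hX0 : 0 < X := lt_of_lt_of_le (by positivity) hX
  have hX1 : 1 ≤ X := by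
    have h1 : 1 ≤ Real.exp (10 / δ) := Real.one_le_exp (by positivity)
    have h2 : (1 : ℝ) ≤ 3 ^ (1 / α) := Real.one_le_rpow (by norm_num) (by positivity)
    nlinarith
  have hX4 : 1 ≤ X ^ 4 := one_le_pow₀ hX1
  have hy4 : 4 ≤ y ^ 2 := by nlinarith
  -- Times up to about `N/D` meet two demands: `t ≤ N/y²`, so that `density_bounds` applies, and `t
  -- + 1 ≤ 1/s²`, so that the weight there dominates `exp(sρ)`.
  set D := y ^ 2 + s ^ 2 * N with hD
  have hsN : 0 ≤ s ^ 2 * N := by positivity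
  have hD0 : 0 < D := by positivity
  set m := ⌊(N : ℝ) / D⌋₊ with hm
  have hmle : (m : ℝ) * D ≤ N := by
    rw [← le_div_iff₀ hD0]; exact Nat.floor_le (by positivity)
  have hmlt : (N : ℝ) < (m + 1) * D := by
    rw [← div_lt_iff₀ hD0]; exact Nat.lt_floor_add_one _
  -- For `m = 0` the truncated subtraction gives `t = 0`. The weighted norm of the initial point
  -- mass does not depend on `s`, since `ρ x₀ = 0`.
  set t := m - 1 with ht
  have htm : (t : ℝ) ≤ m := by exact_mod_cast Nat.sub_le m 1
  have htN : (t : ℝ) * y ^ 2 ≤ √(N : ℝ) ^ 2 := by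
    rw [hr2]
    nlinarith [mul_le_mul_of_nonneg_right htm hD0.le, t.cast_nonneg (α := ℝ),
      mul_nonneg (t.cast_nonneg (α := ℝ)) hsN]
  have htn : t ≤ n := by
    have h1 : (t : ℝ) * 4 ≤ N := by
      rw [hr2] at htN; nlinarith [t.cast_nonneg (α := ℝ)]
    have h2 : t * 4 ≤ N := by exact_mod_cast h1
    omega
  obtain ⟨hM, hW⟩ := density_bounds (x₀ := x₀) hδ0 hδ h hr hC hα hF hρ0 hρx hρ hB hB1 hB2 hX
    hy2 hy t htN
  have hb0 := decayBound_pos (α := α) hB hr hF t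
  have e1 : k.weightedNormSq ρ s (k.density x₀ t) ≤ X ^ 4 * decayBound B α (√N) F t := by
    rcases Nat.eq_zero_or_pos m with h0 | h0
    · have ht0 : t = 0 := by omega
      rw [ht0, ip_density_zero] at hM
      rw [ht0] at hb0 ⊢
      rw [weightedNormSq_density_zero _ _ hρx]
      nlinarith
    · have hmt : (t : ℝ) + 1 = m := by
        have : t + 1 = m := by omega
        exact_mod_cast this
      refine (k.weightedNormSq_mono hρ0 ?_ _).trans hW
      rw [hmt, le_div_iff₀ (by positivity)]
      refine le_of_sq_le_sq ?_ zero_le_one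
      rw [mul_pow, Real.sq_sqrt (by positivity), one_pow]
      have h1 : s ^ 2 * m * N ≤ 1 * N := by
        nlinarith [mul_nonneg (m.cast_nonneg (α := ℝ)) (sq_nonneg y)]
      exact le_of_mul_le_mul_right h1 hNr
  obtain ⟨l, hl⟩ : ∃ l, n = l + t := ⟨n - t, by omega⟩
  have e2 := k.weightedNormSq_iterate_le hδ0 hδ hρ hs (k.density x₀ t) l
  rw [← density_add, ← hl] at e2
  have e3 : Real.exp (10 / δ * s ^ 2 * l) ≤ Real.exp (10 / δ * (s ^ 2 * N)) := by
    refine Real.exp_le_exp.2 ?_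
    have : (l : ℝ) ≤ N := by
      have : l ≤ N := by omega
      exact_mod_cast this
    rw [mul_assoc]
    gcongr
  have e4 : decayBound B α (√N) F t ≤
      8 * ((B * 2) ^ (1 / α) * (Real.exp (y ^ 2 / α) * Real.exp (1 / α * (s ^ 2 * N)))) / F := by
    have h2 : Real.exp (y ^ 2 / α) * Real.exp (1 / α * (s ^ 2 * N)) = Real.exp (D / α) := by
      rw [← Real.exp_add, hD]; congr 1; ring
    rw [h2]
    refine decayBound_le_exp hB hα hr hF ?_
    rw [hr2, div_le_iff₀ (by positivity)]
    have h3 : (m : ℝ) + 1 ≤ 2 * (t + 1) := by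
      have : m + 1 ≤ 2 * (t + 1) := by omega
      exact_mod_cast this
    linarith [mul_le_mul_of_nonneg_right h3 hD0.le]
  calc _ ≤ Real.exp (10 / δ * (s ^ 2 * N)) * (X ^ 4 * decayBound B α (√N) F t) :=
        e2.trans (mul_le_mul e3 e1 (k.ip_self_nonneg _) (Real.exp_pos _).le)
    _ ≤ Real.exp (10 / δ * (s ^ 2 * N)) * (X ^ 4 * (8 * ((B * 2) ^ (1 / α) *
          (Real.exp (y ^ 2 / α) * Real.exp (1 / α * (s ^ 2 * N)))) / F)) :=
        mul_le_mul_of_nonneg_left (mul_le_mul_of_nonneg_left e4 (by linarith))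
          (Real.exp_pos _).le
    _ = _ := by
      rw [add_mul, Real.exp_add]; ring

end LazyKernel

/-! ### Gaussian bound on a finite set -/

namespace LazyKernel

lemma ip_le_sqrt_mul_sqrt {ι : Type*} [Fintype ι] {δ : ℝ} (k : LazyKernel ι δ) (f g : ι → ℝ) :
    k.ip f g ≤ √(k.ip f f) * √(k.ip g g) := by
  have h := Real.sum_mul_le_sqrt_mul_sqrt Finset.univ (fun x => f x * √(k.π x))
    (fun x => g x * √(k.π x))
  have e : ∀ u v : ι → ℝ, ∑ x, (u x * √(k.π x)) * (v x * √(k.π x)) = k.ip u v := fun u v =>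
    Finset.sum_congr rfl fun x _ => by
      have := Real.mul_self_sqrt (k.π_pos x).le
      linear_combination u x * v x * this
  simp only [sq, e] at h
  exact h

/-- The Gaussian upper bound on a finite set. -/
theorem density_gaussian_bound {δ C α : ℝ} (hδ0 : 0 < δ) (hδ : δ < 1) (hC : 0 < C)
    (hα : 0 < α) : ∃ c₁ c₂ : ℝ, 0 < c₁ ∧ 0 < c₂ ∧
    ∀ (ι : Type*) [Fintype ι] [DecidableEq ι] (k : LazyKernel ι δ) (d : ι → ι → ℝ)
      (N : ℕ) (x y : ι) (Fx Fy : ℝ), 0 < N → 0 < Fx → 0 < Fy →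
      (∀ u v, 0 ≤ d u v) → (∀ u, d u u = 0) → (∀ u v, d u v = d v u) →
      (∀ u v z, d u v ≤ d u z + d z v) → (∀ u v, k.a u v ≠ 0 → d u v ≤ 1) →
      k.FaberKrahn (d x) (√N) C α Fx → k.FaberKrahn (d y) (√N) C α Fy →
      k.density y N x ≤ c₁ / √(Fx * Fy) * Real.exp (-(d x y ^ 2) / (c₂ * N)) := by
  set B := 32 / C + 8 * (1 + 1 / α) / (δ * C) with hBdef
  have hB : 0 < B := by positivity
  have hB1 : 32 ≤ C * B := by
    have : C * B = 32 + 8 * (1 + 1 / α) / δ := by rw [hBdef]; field_simp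
    rw [this]; linarith [(by positivity : 0 < 8 * (1 + 1 / α) / δ)]
  have hB2 : 8 * (1 + 1 / α) ≤ δ * C * B := by
    have : δ * C * B = 32 * δ + 8 * (1 + 1 / α) := by rw [hBdef]; field_simp
    rw [this]; linarith
  set X := 2 * Real.exp (10 / δ) * (3 : ℝ) ^ (1 / α) with hX
  have hX0 : 0 < X := by positivity
  set Y := 2 + 2 * X ^ 4 * (2 : ℝ) ^ (1 / α) with hY
  have hY2 : 2 ≤ Y := by linarith [(by positivity : 0 < 2 * X ^ 4 * (2 : ℝ) ^ (1 / α))]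
  set A := 8 * X ^ 4 * (B * 2) ^ (1 / α) * Real.exp (Y ^ 2 / α) with hA
  have hA0 : 0 < A := by positivity
  set E := 10 / δ + 1 / α with hE
  have hE0 : 0 < E := by positivity
  refine ⟨A, 4 * E, hA0, by positivity, ?_⟩
  intro ι _ _ k d N x y Fx Fy hN hFx hFy hd0 hdd hds hdt hda hx hy
  have hNr : (0 : ℝ) < N := Nat.cast_pos.2 hN
  have hlip : ∀ z u v, k.a u v ≠ 0 → |d z u - d z v| ≤ 1 := fun z u v huv => by
    have h1 := hda u v huv
    rw [abs_le]
    constructor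
    · linarith [hdt z v u]
    · linarith [hdt z u v, hds u v]
  -- Minimiser of `E s² N - s d(x,y)`, with minimum `-d(x,y)²/(4EN)`; hence `c₂ = 4E`.
  set s := d x y / (2 * E * N) with hs
  have hs0 : 0 ≤ s := div_nonneg (hd0 x y) (by positivity)
  set m := N / 2 with hm
  set n := N - N / 2 with hn
  have hmn : m + n = N := by omega
  have h1 := weightedNormSq_density_le (x₀ := x) hδ0 hδ hN hx hC hα hFx (hd0 x) (hdd x) (hlip x)
    hB hB1 hB2 hX.ge hY2 (by linarith) hs0 (n := m) le_rfl (by omega)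
  have h2 := weightedNormSq_density_le (x₀ := y) hδ0 hδ hN hy hC hα hFy (hd0 y) (hdd y) (hlip y)
    hB hB1 hB2 hX.ge hY2 (by linarith) hs0 (n := n) (by omega) (by omega)
  rw [← hA, ← hE] at h1 h2
  have h3 : Real.exp (s * d x y) * k.density y N x ≤
      √(k.weightedNormSq (d x) s (k.density x m)) *
        √(k.weightedNormSq (d y) s (k.density y n)) := by
    rw [← hmn, density_add_apply]
    refine le_trans ?_ (k.ip_le_sqrt_mul_sqrt _ _)
    rw [ip, Finset.mul_sum, ip]
    refine Finset.sum_le_sum fun z _ => ?_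
    have e : Real.exp (s * d x y) ≤ Real.exp (s * d x z) * Real.exp (s * d y z) := by
      rw [← Real.exp_add]
      refine Real.exp_le_exp.2 ?_
      nlinarith [hdt x y z, hds y z]
    have e0 : 0 ≤ k.density x m z * k.density y n z * k.π z :=
      mul_nonneg (mul_nonneg (k.density_nonneg _ _ _) (k.density_nonneg _ _ _)) (k.π_pos z).le
    nlinarith [mul_le_mul_of_nonneg_right e e0]
  have h4 : √(k.weightedNormSq (d x) s (k.density x m)) *
      √(k.weightedNormSq (d y) s (k.density y n)) ≤
      A / √(Fx * Fy) * Real.exp (E * (s ^ 2 * N)) := by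
    refine (mul_le_mul (Real.sqrt_le_sqrt h1) (Real.sqrt_le_sqrt h2) (Real.sqrt_nonneg _)
      (Real.sqrt_nonneg _)).trans (le_of_eq ?_)
    rw [← Real.sqrt_mul (by positivity)]
    have e : A / Fx * Real.exp (E * (s ^ 2 * N)) * (A / Fy * Real.exp (E * (s ^ 2 * N))) =
        (A * Real.exp (E * (s ^ 2 * N))) ^ 2 / (Fx * Fy) := by field_simp
    rw [e, Real.sqrt_div (by positivity), Real.sqrt_sq (by positivity)]
    ring
  have h5 : -(d x y ^ 2) / (4 * E * N) = E * (s ^ 2 * N) - s * d x y := by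
    rw [hs]; field_simp; ring
  rw [h5, Real.exp_sub, ← mul_div_assoc, le_div_iff₀ (Real.exp_pos _), mul_comm]
  exact h3.trans h4

end LazyKernel

end

/-! ### Reduction of the graph to finite sets -/

noncomputable section

namespace WeightedGraph

variable {V : Type u} {G : SimpleGraph V} (w : WeightedGraph G)

lemma μ_self (x : V) : w.μ x x = 0 := by
  by_contra h
  exact G.irrefl ((w.μ_adapted x x).1 h)

lemma tsum_div_mul (x : V) : (∑' z, w.μ x z / w.π x) * w.π x = ∑' z, w.μ x z := by
  rw [tsum_div_const, div_mul_cancel₀ _ (w.π_pos x).ne']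

open Classical in
lemma markovKernel_mul (x y : V) : w.markovKernel x y * w.π x =
    (if x = y then w.π x - ∑' z, w.μ x z else 0) + w.μ x y := by
  unfold markovKernel
  split_ifs with h
  · rw [sub_mul, tsum_div_mul, ← h, μ_self]; ring
  · rw [div_mul_cancel₀ _ (w.π_pos x).ne', zero_add]

lemma eq_or_adj_of_markovKernel_ne_zero {x y : V} (h : w.markovKernel x y ≠ 0) :
    x = y ∨ G.Adj x y := by
  by_contra! hn
  have : w.μ x y = 0 := by
    by_contra hμ
    exact hn.2 ((w.μ_adapted x y).1 hμ)
  simp [markovKernel, hn.1, this] at h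

open Classical in
/-- The restriction of the random walk to a finite set, killed outside. -/
def restrict {Ce : ℝ} (h : w.UniformlyLazy Ce) (S : Finset V) : LazyKernel S Ce where
  a x y := w.markovKernel x y * w.π x
  π x := w.π x
  a_nonneg x y := by
    rw [markovKernel_mul]
    refine add_nonneg ?_ (w.μ_nonneg _ _)
    split_ifs
    · exact sub_nonneg.2 (w.μ_subordinate _)
    · exact le_rfl
  a_symm x y := by
    rw [markovKernel_mul, markovKernel_mul, w.μ_symm x y]
    rcases eq_or_ne (x : V) y with hxy | hxy
    · simp [hxy]
    · simp [hxy, hxy.symm]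
  π_pos x := w.π_pos x
  sum_le x := by
    simp only [markovKernel_mul]
    rw [Finset.sum_coe_sort S fun y =>
      (if (x : V) = y then w.π x - ∑' z, w.μ x z else 0) + w.μ x y,
      Finset.sum_add_distrib, Finset.sum_ite_eq, if_pos x.2]
    have := (w.μ_summable x).sum_le_tsum S fun y _ => w.μ_nonneg x y
    linarith
  lazy x := by
    rw [markovKernel_mul, if_pos rfl, μ_self, add_zero]
    linarith [h x]

section restrict

variable {Ce : ℝ} (h : w.UniformlyLazy Ce)

/-- Finite propagation speed: a walk started in `S i` is in `S (i + n) ⊆ S R` after `n` steps, so it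
never feels the killing outside `S R`. The index `i` varies to make the induction on `n` work. -/
lemma heatKernel_eq_density [DecidableEq V] {S : ℕ → Finset V} (hS : Monotone S)
    (hadj : ∀ i, ∀ z ∈ S i, ∀ v, G.Adj z v → v ∈ S (i + 1)) {R : ℕ} (y : S R) (n : ℕ) :
    ∀ i, i + n ≤ R → ∀ z : S R, (z : V) ∈ S i →
      w.heatKernel n z y = (w.restrict h (S R)).density y n z := by
  induction n with
  | zero =>
    intro i _ z _
    rw [LazyKernel.density_zero, heatKernel, markovKernelPow, Pi.single_apply]
    rcases eq_or_ne z y with hzy | hzy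
    · simp [hzy, restrict]
    · simp [hzy, Subtype.coe_injective.ne hzy]
  | succ n ih =>
    intro i hi z hz
    have hsupp : ∀ v, w.markovKernel z v ≠ 0 → v ∈ S (i + 1) := fun v hv => by
      rcases w.eq_or_adj_of_markovKernel_ne_zero hv with rfl | hv
      · exact hS (Nat.le_succ i) hz
      · exact hadj i z hz v hv
    have h1 : w.heatKernel (n + 1) z y =
        ∑ v ∈ S R, w.markovKernel z v * w.heatKernel n v y := by
      simp only [heatKernel, markovKernelPow]
      rw [tsum_eq_sum (s := S R), Finset.sum_div]
      · exact Finset.sum_congr rfl fun v _ => mul_div_assoc _ _ _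
      · intro v hv
        by_contra hne
        exact hv (hS (by omega) (hsupp v (left_ne_zero_of_mul hne)))
    rw [h1, LazyKernel.density_succ, LazyKernel.op, Finset.sum_div,
      ← Finset.sum_coe_sort (S R)]
    refine Finset.sum_congr rfl fun v _ => ?_
    rcases eq_or_ne (w.markovKernel z v) 0 with h0 | h0
    · simp [restrict, h0]
    · rw [ih (i + 1) (by omega) v (hsupp v h0)]
      have := (w.π_pos z).ne'
      simp only [restrict]
      field_simp

lemma energy_eq {f : V → ℝ} {S : Finset V} (hf : ∀ x ∉ S, f x = 0) :
    w.energy f = ∑ x ∈ S, f x ^ 2 * ∑' y, w.μ x y - ∑ x ∈ S, ∑ y ∈ S, w.μ x y * f x * f y := by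
  have h1 : ∀ x, ∑' y, |f x - f y| ^ 2 * w.μ x y =
      f x ^ 2 * ∑' y, w.μ x y + (∑ y ∈ S, f y ^ 2 * w.μ x y -
        2 * ∑ y ∈ S, w.μ x y * f x * f y) := fun x => by
    have e1 : HasSum (fun y => f x ^ 2 * w.μ x y) (f x ^ 2 * ∑' y, w.μ x y) :=
      (w.μ_summable x).hasSum.mul_left _
    have e2 : HasSum (fun y => f y ^ 2 * w.μ x y - 2 * (w.μ x y * f x * f y))
        (∑ y ∈ S, (f y ^ 2 * w.μ x y - 2 * (w.μ x y * f x * f y))) :=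
      hasSum_sum_of_ne_finset_zero fun y hy => by simp [hf y hy]
    rw [Finset.mul_sum, ← Finset.sum_sub_distrib, ← (e1.add e2).tsum_eq]
    refine tsum_congr fun y => ?_
    rw [sq_abs]; ring
  have e1 : HasSum (fun x => f x ^ 2 * ∑' y, w.μ x y) (∑ x ∈ S, f x ^ 2 * ∑' y, w.μ x y) :=
    hasSum_sum_of_ne_finset_zero fun x hx => by simp [hf x hx]
  have e2 : HasSum (fun x => ∑ y ∈ S, f y ^ 2 * w.μ x y) (∑ y ∈ S, f y ^ 2 * ∑' x, w.μ y x) :=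
    hasSum_sum fun y _ => by
      simp only [w.μ_symm _ y]
      exact (w.μ_summable y).hasSum.mul_left _
  have e3 : HasSum (fun x => 2 * ∑ y ∈ S, w.μ x y * f x * f y)
      (2 * ∑ x ∈ S, ∑ y ∈ S, w.μ x y * f x * f y) :=
    (hasSum_sum_of_ne_finset_zero fun x hx => by simp [hf x hx]).mul_left _
  rw [energy, tsum_congr h1, (e1.add (e2.sub e3)).tsum_eq]
  ring

/-- Edges leaving `S` contribute to the energy exactly the killing term of the restricted walk, so
Faber–Krahn passes to `restrict` with the same constants. -/
lemma energy_eq_dirichlet {f : V → ℝ} {S : Finset V} (hf : ∀ x ∉ S, f x = 0) :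
    w.energy f = (w.restrict h S).dirichlet fun x => f x := by
  classical
  rw [w.energy_eq hf, LazyKernel.dirichlet, LazyKernel.ip, LazyKernel.form]
  simp only [restrict, markovKernel_mul]
  rw [Finset.sum_coe_sort S fun x => f x * f x * w.π x,
    Finset.sum_coe_sort S fun x => ∑ y : S,
      ((if x = y then w.π x - ∑' z, w.μ x z else 0) + w.μ x y) * f x * f y]
  have h1 : ∀ x ∈ S, ∑ y : S,
      ((if x = y then w.π x - ∑' z, w.μ x z else 0) + w.μ x y) * f x * f y =
      f x * f x * w.π x - f x ^ 2 * ∑' z, w.μ x z + ∑ y ∈ S, w.μ x y * f x * f y := by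
    intro x hx
    rw [Finset.sum_coe_sort S fun y =>
      ((if x = y then w.π x - ∑' z, w.μ x z else 0) + w.μ x y) * f x * f y]
    simp only [add_mul, Finset.sum_add_distrib, ite_mul, zero_mul, Finset.sum_ite_eq, if_pos hx]
    ring
  rw [Finset.sum_congr rfl h1, Finset.sum_add_distrib, Finset.sum_sub_distrib]
  ring

lemma normSq_eq_ip {f : V → ℝ} {S : Finset V} (hf : ∀ x ∉ S, f x = 0) :
    w.normSq f = (w.restrict h S).ip (fun x => f x) fun x => f x := by
  rw [normSq, tsum_eq_sum (s := S) fun x hx => by simp [hf x hx], LazyKernel.ip]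
  simp only [restrict]
  rw [Finset.sum_coe_sort S fun x => f x * f x * w.π x]
  exact Finset.sum_congr rfl fun x _ => by rw [sq_abs, sq]

lemma dirichletEigenvalue_mul_le {f : V → ℝ} {Ω : Finset V} (hf : ∀ x ∉ Ω, f x = 0) :
    w.dirichletEigenvalue Ω * w.normSq f ≤ w.energy f := by
  have he : ∀ g, 0 ≤ w.energy g := fun g =>
    mul_nonneg (by norm_num) (tsum_nonneg fun x => tsum_nonneg fun y =>
      mul_nonneg (sq_nonneg _) (w.μ_nonneg x y))
  have hn : ∀ g, 0 ≤ w.normSq g := fun g =>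
    tsum_nonneg fun x => mul_nonneg (sq_nonneg _) (w.π_pos x).le
  rcases (hn f).eq_or_lt with h0 | h0
  · rw [← h0, mul_zero]; exact he f
  rw [← le_div_iff₀ h0]
  refine csInf_le ⟨0, ?_⟩ ⟨f, fun x hx => ?_, ?_, rfl⟩
  · rintro _ ⟨g, -, -, rfl⟩
    exact div_nonneg (he g) (hn g)
  · by_contra hx'
    exact hx (hf x hx')
  · rintro rfl
    simp [normSq] at h0

lemma IsRelativeFaberKrahn.restrict {w : WeightedGraph G} {C α : ℝ} {F : V → ℝ → ℝ}
    (hF : w.IsRelativeFaberKrahn fun z r ν => C / r ^ 2 * (F z r / ν) ^ α)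
    (h : w.UniformlyLazy Ce) (S : Finset V) (z : S) {r : ℝ} (hr : 1 ≤ r) :
    (w.restrict h S).FaberKrahn (fun x => (G.dist z x : ℝ)) r C α (F z r) := by
  classical
  intro Ω hΩ hball f hf
  set g : V → ℝ := fun v => if hv : v ∈ S then f ⟨v, hv⟩ else 0 with hg
  have hgf : (fun x : S => g x) = f := by
    ext x; simp [hg]
  set Ω' := Ω.map (Function.Embedding.subtype _) with hΩ'
  have hgΩ : ∀ x ∉ Ω', g x = 0 := fun x hx => by
    by_cases hxS : x ∈ S
    · have : (⟨x, hxS⟩ : S) ∉ Ω := fun hmem => hx (Finset.mem_map_of_mem _ hmem)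
      simp [hg, hxS, hf _ this]
    · simp [hg, hxS]
  have hgS : ∀ x ∉ S, g x = 0 := fun x hx => by simp [hg, hx]
  have h1 := hF.le_eigenvalue z r hr Ω' (hΩ.map) (fun x hx => by
    obtain ⟨v, hv, rfl⟩ := Finset.mem_map.1 hx
    exact hball v hv)
  have h2 : ∑ x ∈ Ω', w.π x = ∑ x ∈ Ω, (w.restrict h S).π x := by
    rw [hΩ', Finset.sum_map]; rfl
  have h3 := w.dirichletEigenvalue_mul_le hgΩ
  rw [w.energy_eq_dirichlet h hgS, w.normSq_eq_ip h hgS, hgf] at h3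
  simp only [h2] at h1
  exact (mul_le_mul_of_nonneg_right h1 ((w.restrict h S).ip_self_nonneg f)).trans h3

end restrict

/-- The weights at `x` are summable, while each edge carries at least `π x / Cc`. -/
lemma finite_setOf_adj {Cc : ℝ} (hCc : 0 < Cc) (hw : w.ControlledWeights Cc) (x : V) :
    {y | G.Adj x y}.Finite := by
  have h := (w.μ_summable x).tendsto_cofinite_zero.eventually_lt_const
    (mul_pos (one_div_pos.2 hCc) (w.π_pos x))
  rw [Filter.eventually_cofinite] at h
  refine h.subset fun y hy => not_lt.2 ?_
  rw [← le_div_iff₀ (w.π_pos x)]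
  exact hw x y hy

lemma exists_exhaustion {Cc : ℝ} (hCc : 0 < Cc) (hw : w.ControlledWeights Cc) (A : Finset V) :
    ∃ S : ℕ → Finset V, S 0 = A ∧ Monotone S ∧
      ∀ i, ∀ z ∈ S i, ∀ v, G.Adj z v → v ∈ S (i + 1) := by
  classical
  let step : Finset V → Finset V := fun B =>
    B ∪ B.biUnion fun z => (w.finite_setOf_adj hCc hw z).toFinset
  refine ⟨fun i => step^[i] A, rfl, monotone_nat_of_le_succ fun i => ?_, fun i z hz v hv => ?_⟩
  · rw [Function.iterate_succ_apply']
    exact Finset.subset_union_left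
  · change v ∈ step^[i + 1] A
    rw [Function.iterate_succ_apply']
    exact Finset.mem_union_right _ (Finset.mem_biUnion.2 ⟨z, hz, by simpa using hv⟩)

end WeightedGraph

end

theorem theorem4p4 (Cc Ce C α : ℝ) (hCc : 1 < Cc) (hCe0 : 0 < Ce) (hCe1 : Ce < 1)
    (hC : 0 < C) (hα : 0 < α) :
    ∃ c₁ c₂ : ℝ, 0 < c₁ ∧ 0 < c₂ ∧
      ∀ (V : Type u) [Infinite V] (G : SimpleGraph V) (w : WeightedGraph G) (F : V → ℝ → ℝ),
        G.Connected → w.ControlledWeights Cc → w.UniformlyLazy Ce →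
        (∀ (z : V) (r : ℝ), 1 ≤ r → 0 < F z r) →
        w.IsRelativeFaberKrahn (fun z r ν => C / r ^ 2 * (F z r / ν) ^ α) →
        ∀ (n : ℕ) (x y : V), 0 < n →
          w.heatKernel n x y ≤
            c₁ / Real.sqrt (F x (Real.sqrt n) * F y (Real.sqrt n)) *
              Real.exp (-((G.dist x y : ℝ) ^ 2) / (c₂ * n)) := by
  obtain ⟨c₁, c₂, h1, h2, key⟩ := LazyKernel.density_gaussian_bound.{u} hCe0 hCe1 hC hα
  refine ⟨c₁, c₂, h1, h2, ?_⟩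
  intro V _ G w F hG hw hlazy hF hFK n x y hn
  classical
  -- The finite set `S n` depends on `x`, `y`, `n`, which is harmless because the constants from
  -- `key` do not depend on the set.
  obtain ⟨S, hS0, hSm, hSadj⟩ := w.exists_exhaustion (by linarith) hw {x, y}
  have hx : x ∈ S 0 := by simp [hS0]
  have hy : y ∈ S 0 := by simp [hS0]
  have hr : 1 ≤ √(n : ℝ) := Real.one_le_sqrt.2 (by exact_mod_cast hn)
  let x' : S n := ⟨x, hSm n.zero_le hx⟩
  let y' : S n := ⟨y, hSm n.zero_le hy⟩
  have e := w.heatKernel_eq_density hlazy hSm hSadj (R := n) y' n 0 (by omega) x' hx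
  rw [show w.heatKernel n x y = _ from e]
  refine key (S n) (w.restrict hlazy (S n)) (fun u v => (G.dist u v : ℝ)) n x' y' _ _ hn
    (hF x _ hr) (hF y _ hr) (fun _ _ => Nat.cast_nonneg _) (fun _ => by simp)
    (fun u v => by rw [G.dist_comm]) (fun u v z => by exact_mod_cast hG.dist_triangle)
    (fun u v huv => ?_) (hFK.restrict hlazy (S n) x' hr) (hFK.restrict hlazy (S n) y' hr)
  rcases w.eq_or_adj_of_markovKernel_ne_zero (left_ne_zero_of_mul huv) with h | h
  · simp [h]
  · simp [SimpleGraph.dist_eq_one_iff_adj.2 h]
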